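/- Conventions. Work in max algebra on $\mathbb{R}_+=[0,\infty)$: $a\oplus b=\max(a,b)$ with the usual product, $(A\otimes B)_{ij}=\max_k a_{ik}b_{kj}$, and $A^{\otimes t}=(a^{(t)}_{ij})$, where $A^{\otimes 0}$ is the identity matrix. For $A\in\mathbb{R}_+^{n\times n}$, the digraph $\mathcal{D}(A)$ has nodes $1,\dots,n$ and an edge $(i,j)$ whenever $a_{ij}\neq 0$; $A$ is irreducible if $\mathcal{D}(A)$ is strongly connected. A cycle is a closed walk in which no node except for the start and the end appears more than once. $\lambda(A)$ is the maximum over all nonempty cycles $C$ of $\mathcal{D}(A)$ of $p(C)^{1/\ell(C)}$, where $p(C)$ is the product of the weights of the edges of $C$ and $\ell(C)$ is its length ($\lambda(A)=0$ if there is no nonempty cycle). Cycles attaining this maximum are critical, and so are their nodes and edges; the critical nodes and edges form the critical graph $\mathcal{C}(A)$. The transient of the $k$-th row of $A$ is the least $t\ge 0$ such that, for some $p>0$, $a^{(p+t)}_{ki}=\lambda(A)^p a^{(t)}_{ki}$ for all $i$; the transient of the $k$-th column is defined in the same way with $a_{ik}$ in place of $a_{ki}$. The girth $g(H)$ of a digraph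 $H$ is the smallest length of a nonempty cycle of $H$; the cyclicity of a strongly connected digraph is the greatest common divisor of the lengths of its cycles. Let $\mathrm{Wi}(1)=0$ and $\mathrm{Wi}(m)=(m-1)^2+1$ for $m>1$. The factor rank of $A$ is the least $r$ such that $A=V\otimes W^T$ for some $V,W\in\mathbb{R}_+^{n\times r}$. Theorem. Let $A\in\mathbb{R}_+^{n\times n}$ have factor rank $r$, let $A=V\otimes W^T$ with $V,W\in\mathbb{R}_+^{n\times r}$, and let $k$ be a critical node of $A$. Let $H$ be the strongly connected component of $\mathcal{C}(A)$ containing $k$, and $|H|$ its number of nodes. Put $$Z=\begin{pmatrix}0&V\\ W^T&0\end{pmatrix}\in\mathbb{R}_+^{(n+r)\times(n+r)},$$ let $H'$ be the set of nodes in $\{n+1,\dots,n+r\}$ of the strongly connected component of $\mathcal{C}(Z)$ containing $k$, and let $h=\min(|H|,|H'|)$. Then $h\le\min(|H|,r)$, the transients of the $k$-th row and of the $k$-th column of $A$ exist, and both are at most each of (i) $\mathrm{Wi}(r)+1$; (ii) $(r-2)\,g(H)+h+1$. If moreover $A$ is irreducible and $d$ is the cyclicity of $\mathcal{D}(A)$,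 then both are also at most each of (iii) $d\cdot\mathrm{Wi}(\lfloor r/d\rfloor)+(r\bmod d)+1$; (iv) $(\lfloor r/d\rfloor-2)\,g(H)+\min(r,\,h+(r\bmod d))+1$. -/

import Mathlib

open scoped NNReal

namespace MaxAlg

noncomputable section

/-! ### Digraphs, walks, cycles -/

/-- The sequence `w 0, w 1, …, w ℓ` is a walk of length `ℓ` in the digraph `G`.
(The values `w i` with `i > ℓ` play no role.) -/
def IsWalk {ι : Type*} (G : Digraph ι) (ℓ : ℕ) (w : ℕ → ι) : Prop :=
  ∀ i < ℓ, G.Adj (w i) (w (i + 1))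

/-- There is a walk (possibly empty) from `i` to `j` in `G`. -/
def Reaches {ι : Type*} (G : Digraph ι) (i j : ι) : Prop :=
  ∃ (ℓ : ℕ) (w : ℕ → ι), IsWalk G ℓ w ∧ w 0 = i ∧ w ℓ = j

/-- The digraph `G` is strongly connected. -/
def StronglyConnected {ι : Type*} (G : Digraph ι) : Prop :=
  ∀ i j, Reaches G i j

/-- The sequence `w 0, w 1, …, w ℓ = w 0` is a nonempty cycle of length `ℓ` in `G`: a closed walk
in which no node except for the start and the end appears more than once. -/
def IsCycle {ι : Type*} (G : Digraph ι) (ℓ : ℕ) (w : ℕ → ι) : Prop :=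
  0 < ℓ ∧ IsWalk G ℓ w ∧ w ℓ = w 0 ∧ Set.InjOn w (Set.Iio ℓ)

/-- The cyclicity of `G`: the greatest common divisor of the lengths of all its cycles. -/
def cyclicity {ι : Type*} (G : Digraph ι) : ℕ :=
  Nat.setGcd {ℓ | ∃ w, IsCycle G ℓ w}

/-- The girth of `G`: the smallest length of a nonempty cycle of `G`. -/
def girth {ι : Type*} (G : Digraph ι) : ℕ :=
  sInf {ℓ | ∃ w, IsCycle G ℓ w}

/-- The node set of the strongly connected component of `G` containing `k`. -/
def componentNodes {ι : Type*} (G : Digraph ι) (k : ι) : Set ι :=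
  {j | Reaches G k j ∧ Reaches G j k}

/-- The strongly connected component of `G` containing `k`, as a digraph: its edges are the edges
of `G` joining two nodes of the component. -/
def component {ι : Type*} (G : Digraph ι) (k : ι) : Digraph ι where
  Adj i j := i ∈ componentNodes G k ∧ j ∈ componentNodes G k ∧ G.Adj i j

/-! ### Max-times algebra on the nonnegative reals -/

/-- The max-algebraic product of matrices, `(A ⊗ B)_{ij} = max_k a_{ik} b_{kj}`. -/
def maxMul {ι κ μ : Type*} [Fintype κ] (A : Matrix ι κ ℝ≥0) (B : Matrix κ μ ℝ≥0) :
    Matrix ι μ ℝ≥0 :=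
  Matrix.of fun i j => Finset.univ.sup fun k => A i k * B k j

/-- The max-algebraic powers of a square matrix. -/
def maxPow {ι : Type*} [Fintype ι] [DecidableEq ι] (A : Matrix ι ι ℝ≥0) : ℕ → Matrix ι ι ℝ≥0
  | 0 => 1
  | t + 1 => maxMul (maxPow A t) A

/-- The digraph of a matrix: there is an edge from `i` to `j` when `a_{ij} ≠ 0`. -/
def digraph {ι : Type*} (A : Matrix ι ι ℝ≥0) : Digraph ι where
  Adj i j := A i j ≠ 0

/-- `A` is irreducible: its digraph is strongly connected. -/
def IsIrreducible {ι : Type*} (A : Matrix ι ι ℝ≥0) : Prop :=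
  StronglyConnected (digraph A)

/-- The weight of the walk `w 0, …, w ℓ`: the product of the weights of its edges. -/
def walkWeight {ι : Type*} (A : Matrix ι ι ℝ≥0) (ℓ : ℕ) (w : ℕ → ι) : ℝ≥0 :=
  ∏ i ∈ Finset.range ℓ, A (w i) (w (i + 1))

/-- The geometric mean of the weights of the edges of the walk `w 0, …, w ℓ`. -/
def geomMean {ι : Type*} (A : Matrix ι ι ℝ≥0) (ℓ : ℕ) (w : ℕ → ι) : ℝ≥0 :=
  walkWeight A ℓ w ^ (1 / (ℓ : ℝ))

/-- The maximum geometric cycle mean of `A`; it is `0` if there is no nonempty cycle. (For a finite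
index type the set of cycle means is finite, so the supremum is a maximum.) -/
def maxCycleMean {ι : Type*} (A : Matrix ι ι ℝ≥0) : ℝ≥0 :=
  sSup {x | ∃ ℓ w, IsCycle (digraph A) ℓ w ∧ x = geomMean A ℓ w}

/-- A critical cycle: a nonempty cycle at which the maximum geometric cycle mean is attained. -/
def IsCriticalCycle {ι : Type*} (A : Matrix ι ι ℝ≥0) (ℓ : ℕ) (w : ℕ → ι) : Prop :=
  IsCycle (digraph A) ℓ w ∧ geomMean A ℓ w = maxCycleMean A

/-- A critical node: a node of some critical cycle. -/
def IsCriticalNode {ι : Type*} (A : Matrix ι ι ℝ≥0) (k : ι) : Prop :=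
  ∃ ℓ w, IsCriticalCycle A ℓ w ∧ ∃ i < ℓ, w i = k

/-- The critical graph, whose edges are the edges of the critical cycles. (Its nodes are the
critical nodes; the remaining elements of the index type are isolated in it.) -/
def criticalGraph {ι : Type*} (A : Matrix ι ι ℝ≥0) : Digraph ι where
  Adj a b := ∃ ℓ w, IsCriticalCycle A ℓ w ∧ ∃ i < ℓ, w i = a ∧ w (i + 1) = b

/-- `t` is the transient of the `k`-th row of `A`. -/
def IsRowTransient {ι : Type*} [Fintype ι] [DecidableEq ι] (A : Matrix ι ι ℝ≥0) (k : ι)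
    (t : ℕ) : Prop :=
  IsLeast {t : ℕ | ∃ p : ℕ, 0 < p ∧
    ∀ i, maxPow A (p + t) k i = maxCycleMean A ^ p * maxPow A t k i} t

/-- `t` is the transient of the `k`-th column of `A`. -/
def IsColTransient {ι : Type*} [Fintype ι] [DecidableEq ι] (A : Matrix ι ι ℝ≥0) (k : ι)
    (t : ℕ) : Prop :=
  IsLeast {t : ℕ | ∃ p : ℕ, 0 < p ∧
    ∀ i, maxPow A (p + t) i k = maxCycleMean A ^ p * maxPow A t i k} t

/-! ### Factor rank -/

/-- The columns `v_α`, `w_α` of `V`, `W` satisfy `A = ⨁_α v_α ⊗ w_αᵀ`,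
that is, `a_{ij} = max_α v_{α,i} w_{α,j}`. -/
def IsFactorization {ι ρ : Type*} [Fintype ρ] (A : Matrix ι ι ℝ≥0) (V W : Matrix ι ρ ℝ≥0) :
    Prop :=
  A = maxMul V W.transpose

/-- `r` is the factor rank of `A`: the least number of terms in a representation
`A = ⨁_α v_α ⊗ w_αᵀ`. -/
def IsFactorRank {ι : Type*} (A : Matrix ι ι ℝ≥0) (r : ℕ) : Prop :=
  IsLeast {s : ℕ | ∃ V W : Matrix ι (Fin s) ℝ≥0, IsFactorization A V W} r

/-- The bipartite matrix `Z` with blocks `0, V; Wᵀ, 0`. Its max-algebraic square is block diagonal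
with blocks `A = V ⊗ Wᵀ` and `B = Wᵀ ⊗ V`. -/
def bipartiteMatrix {ι ρ : Type*} (V W : Matrix ι ρ ℝ≥0) : Matrix (ι ⊕ ρ) (ι ⊕ ρ) ℝ≥0 :=
  Matrix.fromBlocks 0 V W.transpose 0

/-- The node set of the component `H'` of the critical graph of `B = Wᵀ ⊗ V` related to the
component `H` of the critical graph of `A` containing `k`. Each component of the critical graph
of `Z` is the disjoint union, as a node set, of a component `H` (nodes of `A`) and its related
component `H'` (nodes of `B`); so `H'` consists of the second-kind nodes of the
component of the critical graph of `Z` containing `k`. -/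
def relatedNodes {ι ρ : Type*} (V W : Matrix ι ρ ℝ≥0) (k : ι) : Set ρ :=
  {β | Sum.inr β ∈ componentNodes (criticalGraph (bipartiteMatrix V W)) (Sum.inl k)}

/-- The Wielandt number: `0` if `k = 1` and `(k - 1)² + 1` if `k > 1`. (The value at `k = 0` is
irrelevant and set to `0`.) -/
def wielandt (k : ℕ) : ℕ :=
  if k ≤ 1 then 0 else (k - 1) ^ 2 + 1

end

end MaxAlg

open MaxAlg

namespace MaxAlg

/-! ### Max-algebraic matrix products and powers -/

/-! Divide `A` by λ(A), so that closed walks have weight at most 1 and critical closed walks have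
weight exactly 1. Write `U = Wᵀ` (with the scaling absorbed), so `A = V ⊗ U`, and let `B = U ⊗ V`,
an r × r matrix. Walks of `A` and of `B` are the even walks of the bipartite matrix `Z`, and a
critical node `k` of `A` has a critical edge of `Z` to a critical node `α` of `B`. Row periodicity
is pulled back along critical walks at the cost of their length (`RowPeriodicFrom.of_critWalk`), so
the transient of `k` in `A` is at most that of `α` in `B`, plus 1. This explains the summand 1 and
why r replaces n.

Two bounds hold for a critical node of a matrix with m reachable nodes. If it lies on a critical
closed walk of length g, then the g-th power has a loop of weight 1 there; longer walks of the power
can be shortened and shorter ones padded, which gives (m-1)g (`rowPeriodicFrom_of_loop`). The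
Wielandt bound (`rowPeriodicFrom_wielandt`) follows by walking to a shortest critical cycle, unless
that cycle passes through all m nodes. In that case the cycle is scaled to unit weights and its
nodes are numbered by `ZMod m`; a walk is then determined by the jumps by which it deviates from the
cycle. A minimal subfamily of jumps with the same sum is zero-sum-free, hence short, and can be
realized in (m-1)²+1 steps (`maxPow_le_of_cycle`).

With d cyclic classes, both bounds apply inside one class, and m becomes its size. A critical walk
meets the classes consecutively, so a class of size at most ⌊r/d⌋ is reached soon
(`exists_small_class`). For the girth bound, a shortest critical walk to a shortest critical cycle,
together with that cycle, uses distinct nodes of the component (`exists_lollipop`). It can be taken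
in `A` or in `B`, whence the minimum h (`rowPeriodicFrom_factorization`).

Columns are rows of the transpose, and the bounds without irreducibility are the case d = 1.
Minimality of r serves only to exclude zero columns of `V` and `W`, so that the classes of `A`
extend to the nodes of `B`. -/

theorem le_maxMul {ι κ μ : Type*} [Fintype κ] (A : Matrix ι κ ℝ≥0) (B : Matrix κ μ ℝ≥0)
    (i : ι) (k : κ) (j : μ) : A i k * B k j ≤ maxMul A B i j :=
  Finset.le_sup (f := fun k => A i k * B k j) (Finset.mem_univ k)

theorem maxMul_le {ι κ μ : Type*} [Fintype κ] {A : Matrix ι κ ℝ≥0} {B : Matrix κ μ ℝ≥0}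
    {i : ι} {j : μ} {c : ℝ≥0} (h : ∀ k, A i k * B k j ≤ c) : maxMul A B i j ≤ c :=
  Finset.sup_le fun k _ => h k

theorem exists_maxMul_eq {ι κ μ : Type*} [Fintype κ] {A : Matrix ι κ ℝ≥0} {B : Matrix κ μ ℝ≥0}
    {i : ι} {j : μ} (h : maxMul A B i j ≠ 0) : ∃ k, A i k * B k j = maxMul A B i j := by
  rcases (Finset.univ : Finset κ).eq_empty_or_nonempty with he | hne
  · exact absurd (by simp [maxMul, he]) h
  · obtain ⟨k, -, hk⟩ := Finset.exists_mem_eq_sup Finset.univ hne (fun k => A i k * B k j)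
    exact ⟨k, hk.symm⟩

theorem maxMul_assoc {ι κ μ ν : Type*} [Fintype κ] [Fintype μ] (A : Matrix ι κ ℝ≥0)
    (B : Matrix κ μ ℝ≥0) (C : Matrix μ ν ℝ≥0) :
    maxMul (maxMul A B) C = maxMul A (maxMul B C) := by
  ext i j : 1
  apply le_antisymm
  · refine maxMul_le fun k => ?_
    by_cases h : maxMul A B i k = 0
    · simp [h]
    · obtain ⟨l, hl⟩ := exists_maxMul_eq h
      rw [← hl, mul_assoc]
      exact (mul_le_mul_right (le_maxMul B C l k j) _).trans (le_maxMul A (maxMul B C) i l j)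
  · refine maxMul_le fun k => ?_
    by_cases h : maxMul B C k j = 0
    · simp [h]
    · obtain ⟨l, hl⟩ := exists_maxMul_eq h
      rw [← hl, ← mul_assoc]
      exact (mul_le_mul_left (le_maxMul A B i k l) _).trans (le_maxMul (maxMul A B) C i l j)

theorem maxMul_one {ι κ : Type*} [Fintype κ] [DecidableEq κ] (A : Matrix ι κ ℝ≥0) :
    maxMul A 1 = A := by
  ext i j : 1
  apply le_antisymm
  · refine maxMul_le fun k => ?_
    by_cases h : k = j
    · subst h; simp
    · simp [Matrix.one_apply_ne h]
  · simpa using le_maxMul A 1 i j j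

theorem one_maxMul {ι κ : Type*} [Fintype ι] [DecidableEq ι] (A : Matrix ι κ ℝ≥0) :
    maxMul 1 A = A := by
  ext i j : 1
  apply le_antisymm
  · refine maxMul_le fun k => ?_
    by_cases h : i = k
    · subst h; simp
    · simp [Matrix.one_apply_ne h]
  · simpa using le_maxMul 1 A i i j

theorem maxMul_transpose {ι κ μ : Type*} [Fintype κ] (A : Matrix ι κ ℝ≥0) (B : Matrix κ μ ℝ≥0) :
    (maxMul A B).transpose = maxMul B.transpose A.transpose := by
  ext i j : 1
  simp [maxMul, Matrix.transpose_apply, mul_comm]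

/-! ### Walks -/

theorem walkWeight_add {ι : Type*} (A : Matrix ι ι ℝ≥0) (s t : ℕ) (w : ℕ → ι) :
    walkWeight A (s + t) w = walkWeight A s w * walkWeight A t (fun i => w (s + i)) := by
  simp only [walkWeight, Finset.prod_range_add, add_assoc]

theorem walkWeight_ne_zero_iff {ι : Type*} {A : Matrix ι ι ℝ≥0} {t : ℕ} {w : ℕ → ι} :
    walkWeight A t w ≠ 0 ↔ IsWalk (digraph A) t w := by
  simp [walkWeight, Finset.prod_ne_zero_iff, IsWalk, digraph]

theorem walkWeight_smul {ι : Type*} (c : ℝ≥0) (A : Matrix ι ι ℝ≥0) (t : ℕ) (w : ℕ → ι) :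
    walkWeight (c • A) t w = c ^ t * walkWeight A t w := by
  simp [walkWeight, Finset.prod_mul_distrib]

section Square

variable {ι : Type*} [Fintype ι] [DecidableEq ι]

theorem maxPow_zero (A : Matrix ι ι ℝ≥0) : maxPow A 0 = 1 := rfl

theorem maxPow_succ (A : Matrix ι ι ℝ≥0) (t : ℕ) :
    maxPow A (t + 1) = maxMul (maxPow A t) A := rfl

theorem maxPow_one (A : Matrix ι ι ℝ≥0) : maxPow A 1 = A := one_maxMul A

theorem maxPow_add (A : Matrix ι ι ℝ≥0) (s t : ℕ) :
    maxPow A (s + t) = maxMul (maxPow A s) (maxPow A t) := by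
  induction t with
  | zero => exact (maxMul_one _).symm
  | succ t ih => rw [← add_assoc, maxPow_succ, ih, maxPow_succ, maxMul_assoc]

theorem maxPow_mul (A : Matrix ι ι ℝ≥0) (s t : ℕ) :
    maxPow A (s * t) = maxPow (maxPow A s) t := by
  induction t with
  | zero => rfl
  | succ t ih => rw [Nat.mul_succ, maxPow_add, ih, maxPow_succ]

theorem le_maxPow_add (A : Matrix ι ι ℝ≥0) (s t : ℕ) (i k j : ι) :
    maxPow A s i k * maxPow A t k j ≤ maxPow A (s + t) i j := by
  rw [maxPow_add]; exact le_maxMul _ _ _ _ _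

theorem exists_maxPow_add_eq {A : Matrix ι ι ℝ≥0} {s t : ℕ} {i j : ι}
    (h : maxPow A (s + t) i j ≠ 0) :
    ∃ k, maxPow A s i k * maxPow A t k j = maxPow A (s + t) i j := by
  rw [maxPow_add] at h ⊢; exact exists_maxMul_eq h

theorem maxPow_transpose (A : Matrix ι ι ℝ≥0) (t : ℕ) :
    maxPow A.transpose t = (maxPow A t).transpose := by
  induction t with
  | zero => simp [maxPow_zero]
  | succ t ih =>
    rw [maxPow_succ, ih, ← maxMul_transpose, add_comm t 1, maxPow_add, maxPow_one]

theorem maxPow_smul (c : ℝ≥0) (A : Matrix ι ι ℝ≥0) (t : ℕ) :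
    maxPow (c • A) t = c ^ t • maxPow A t := by
  induction t with
  | zero => simp [maxPow_zero]
  | succ t ih =>
    ext i j : 1
    simp only [maxPow_succ, ih, maxMul, Matrix.of_apply, Matrix.smul_apply, smul_eq_mul,
      NNReal.mul_finset_sup]
    exact Finset.sup_congr rfl fun k _ => by ring

theorem walkWeight_le_maxPow (A : Matrix ι ι ℝ≥0) (t : ℕ) (w : ℕ → ι) :
    walkWeight A t w ≤ maxPow A t (w 0) (w t) := by
  induction t with
  | zero => simp [walkWeight, maxPow_zero]
  | succ t ih =>
    rw [walkWeight, Finset.prod_range_succ]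
    exact (mul_le_mul_left ih _).trans (le_maxMul (maxPow A t) A _ _ _)

theorem exists_walkWeight_eq {A : Matrix ι ι ℝ≥0} {t : ℕ} {i j : ι} (h : maxPow A t i j ≠ 0) :
    ∃ w : ℕ → ι, w 0 = i ∧ w t = j ∧ walkWeight A t w = maxPow A t i j := by
  induction t generalizing j with
  | zero =>
    have hij : i = j := by
      by_contra hne
      exact h (by simp [maxPow_zero, Matrix.one_apply_ne hne])
    exact ⟨fun _ => i, rfl, hij, by simp [walkWeight, maxPow_zero, hij]⟩
  | succ t ih =>
    obtain ⟨k, hk⟩ := exists_maxMul_eq (A := maxPow A t) (B := A) h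
    have hk0 : maxPow A t i k ≠ 0 := by
      intro h0
      rw [h0, zero_mul] at hk
      exact h hk.symm
    obtain ⟨w, hw0, hwt, hw⟩ := ih hk0
    refine ⟨fun x => if x ≤ t then w x else j, by simpa using hw0, by simp, ?_⟩
    rw [walkWeight, Finset.prod_range_succ, maxPow_succ, ← hk, ← hw, walkWeight]
    congr 1
    · refine Finset.prod_congr rfl fun x hx => ?_
      have := Finset.mem_range.1 hx
      simp [this.le, Nat.succ_le_of_lt this]
    · simp [hwt]

end Square

/-! ### Critical walks of matrices without closed walks of weight exceeding one -/

/-- Every closed walk has weight at most one. -/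
def ClosedLeOne {ι : Type*} [Fintype ι] [DecidableEq ι] (M : Matrix ι ι ℝ≥0) : Prop :=
  ∀ t i, maxPow M t i i ≤ 1

/-- Some closed walk of weight one starts with a walk of length `s` from `a` to `b`. -/
def CritWalk {ι : Type*} [Fintype ι] [DecidableEq ι] (M : Matrix ι ι ℝ≥0) (s : ℕ) (a b : ι) :
    Prop :=
  ∃ s', maxPow M s a b * maxPow M s' b a = 1

/-- The sequence of the `k`-th rows of the powers of `M` is periodic from `X` on. -/
def RowPeriodicFrom {ι : Type*} [Fintype ι] [DecidableEq ι] (M : Matrix ι ι ℝ≥0) (k : ι)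
    (X : ℕ) : Prop :=
  ∃ p, 0 < p ∧ ∀ j, maxPow M (p + X) k j = maxPow M X k j

section Square

variable {ι : Type*} [Fintype ι] [DecidableEq ι] {M : Matrix ι ι ℝ≥0}

theorem ClosedLeOne.critWalk (hM : ClosedLeOne M) {s s' : ℕ} {a b : ι}
    (h : 1 ≤ maxPow M s a b * maxPow M s' b a) : CritWalk M s a b :=
  ⟨s', le_antisymm ((le_maxPow_add M s s' a b a).trans (hM _ _)) h⟩

theorem CritWalk.refl (M : Matrix ι ι ℝ≥0) (a : ι) : CritWalk M 0 a a :=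
  ⟨0, by simp [maxPow_zero]⟩

theorem CritWalk.ne_zero {s : ℕ} {a b : ι} (h : CritWalk M s a b) : maxPow M s a b ≠ 0 := by
  obtain ⟨s', hs⟩ := h
  exact left_ne_zero_of_mul_eq_one hs

theorem CritWalk.symm {s : ℕ} {a b : ι} (h : CritWalk M s a b) : ∃ s', CritWalk M s' b a := by
  obtain ⟨s', hs⟩ := h
  exact ⟨s', s, by rwa [mul_comm]⟩

theorem critWalk_zero_iff {a b : ι} : CritWalk M 0 a b ↔ a = b := by
  constructor
  · intro h
    by_contra hne
    exact h.ne_zero (by simp [maxPow_zero, Matrix.one_apply_ne hne])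
  · rintro rfl
    exact CritWalk.refl M a

theorem CritWalk.trans (hM : ClosedLeOne M) {s t : ℕ} {a b c : ι} (h₁ : CritWalk M s a b)
    (h₂ : CritWalk M t b c) : CritWalk M (s + t) a c := by
  obtain ⟨s', hs⟩ := h₁
  obtain ⟨t', ht⟩ := h₂
  refine hM.critWalk (s' := t' + s') ?_
  calc (1 : ℝ≥0) = (maxPow M s a b * maxPow M t b c) * (maxPow M t' c b * maxPow M s' b a) := by
        rw [← one_mul (1 : ℝ≥0)]; nth_rewrite 1 [← hs]; rw [← ht]; ring
    _ ≤ _ := mul_le_mul' (le_maxPow_add M s t a b c) (le_maxPow_add M t' s' c b a)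

theorem critWalk_self_iff (hM : ClosedLeOne M) {t : ℕ} {a : ι} :
    CritWalk M t a a ↔ maxPow M t a a = 1 := by
  constructor
  · rintro ⟨s', hs⟩
    refine le_antisymm (hM _ _) ?_
    rw [← hs]
    exact mul_le_of_le_one_right' (hM _ _)
  · intro h
    exact ⟨0, by simp [h, maxPow_zero]⟩

theorem CritWalk.mul (hM : ClosedLeOne M) {t : ℕ} {a : ι} (h : CritWalk M t a a) (m : ℕ) :
    CritWalk M (m * t) a a := by
  induction m with
  | zero => simpa using CritWalk.refl M a
  | succ m ih => rw [Nat.succ_mul]; exact ih.trans hM h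

/-- An optimal walk of length `s + t` passes through some midpoint; the rest of the closed walk of
weight one serves as the return for each half. -/
theorem CritWalk.split (hM : ClosedLeOne M) {s t : ℕ} {a b : ι} (h : CritWalk M (s + t) a b) :
    ∃ c, CritWalk M s a c ∧ CritWalk M t c b := by
  obtain ⟨c, hc⟩ := exists_maxPow_add_eq h.ne_zero
  obtain ⟨s', hs⟩ := h
  rw [← hc] at hs
  refine ⟨c, hM.critWalk (s' := t + s') ?_, hM.critWalk (s' := s' + s) ?_⟩
  · rw [← hs, mul_assoc]
    exact mul_le_mul_right (le_maxPow_add M t s' c b a) _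
  · rw [← hs, mul_comm (maxPow M s a c), mul_assoc, mul_comm (maxPow M s a c)]
    exact mul_le_mul_right (le_maxPow_add M s' s b a c) _

theorem CritWalk.exists_walk (hM : ClosedLeOne M) {s : ℕ} {a b : ι} (h : CritWalk M s a b) :
    ∃ w : ℕ → ι, w 0 = a ∧ w s = b ∧ ∀ i j, i ≤ j → j ≤ s → CritWalk M (j - i) (w i) (w j) := by
  induction s generalizing b with
  | zero =>
    rw [critWalk_zero_iff] at h
    refine ⟨fun _ => a, rfl, h, fun i j _ hj => ?_⟩
    obtain rfl : j = 0 := by omega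
    simpa using CritWalk.refl M a
  | succ s ih =>
    obtain ⟨c, hc, hcb⟩ := h.split hM
    obtain ⟨w, hw0, hws, hw⟩ := ih hc
    refine ⟨fun x => if x ≤ s then w x else b, by simpa using hw0, by simp, fun i j hij hj => ?_⟩
    rcases hj.lt_or_eq with hj | rfl
    · have hj' : j ≤ s := by omega
      simpa [hj', hij.trans hj'] using hw i j hij hj'
    · rcases hij.lt_or_eq with hi | rfl
      · have hi' : i ≤ s := by omega
        have := (hw i s hi' le_rfl).trans hM (hws ▸ hcb)
        simpa [hi', Nat.sub_add_comm hi'] using this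
      · simpa using CritWalk.refl M b

/-- Going round the closed walk `s` times takes at least `s` steps, and a prefix of a critical walk
is critical. -/
theorem CritWalk.exists_length (hM : ClosedLeOne M) {p : ℕ} (hp : 0 < p) {a : ι}
    (h : CritWalk M p a a) (s : ℕ) : ∃ b, CritWalk M s a b := by
  have h' := h.mul hM s
  obtain ⟨u, hu⟩ : ∃ u, s * p = s + u := ⟨s * p - s, by
    have := Nat.le_mul_of_pos_right s hp; omega⟩
  rw [hu] at h'
  obtain ⟨b, hb, -⟩ := h'.split hM
  exact ⟨b, hb⟩

theorem CritWalk.exists_return_dvd (hM : ClosedLeOne M) {s : ℕ} {a b : ι} (h : CritWalk M s a b)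
    {p : ℕ} (hp : 0 < p) : ∃ s', p ∣ s' + s ∧ maxPow M s a b * maxPow M s' b a = 1 := by
  obtain ⟨s', hs⟩ := h
  have hc : CritWalk M (s' + s) b b := by
    refine hM.critWalk (s' := 0) ?_
    rw [← hs, mul_comm]
    simpa [maxPow_zero] using le_maxPow_add M s' s b a b
  have hc' := (critWalk_self_iff hM).1 (hc.mul hM (p - 1))
  -- The return is preceded by `p - 1` full circuits, which brings the total length to `p * (s' +
  -- s)` at no loss of weight.
  refine ⟨(p - 1) * (s' + s) + s', ⟨s' + s, ?_⟩, ?_⟩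
  · obtain ⟨q, rfl⟩ : ∃ q, p = q + 1 := ⟨p - 1, by omega⟩
    simp only [Nat.add_sub_cancel]; ring
  · refine le_antisymm ((le_maxPow_add M _ _ a b a).trans (hM _ _)) ?_
    rw [← hs]
    refine mul_le_mul_right ?_ _
    simpa [hc'] using le_maxPow_add M ((p - 1) * (s' + s)) s' b b a

theorem RowPeriodicFrom.mono {k : ι} {X Y : ℕ} (h : RowPeriodicFrom M k X) (hXY : X ≤ Y) :
    RowPeriodicFrom M k Y := by
  obtain ⟨p, hp, h⟩ := h
  obtain ⟨u, rfl⟩ := Nat.exists_eq_add_of_le hXY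
  refine ⟨p, hp, fun j => ?_⟩
  rw [← add_assoc, maxPow_add M (p + X), maxPow_add M X]
  simp only [maxMul, Matrix.of_apply, h]

theorem maxPow_add_mul_period {k : ι} {X p : ℕ}
    (h : ∀ j, maxPow M (p + X) k j = maxPow M X k j) (m : ℕ) {t : ℕ} (ht : X ≤ t) (j : ι) :
    maxPow M (m * p + t) k j = maxPow M t k j := by
  have h1 : ∀ t, X ≤ t → maxPow M (p + t) k j = maxPow M t k j := by
    intro t ht
    obtain ⟨u, rfl⟩ := Nat.exists_eq_add_of_le ht
    rw [← add_assoc, maxPow_add M (p + X), maxPow_add M X]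
    simp only [maxMul, Matrix.of_apply, h]
  induction m with
  | zero => simp
  | succ m ih => rw [Nat.succ_mul, add_comm (m * p) p, add_assoc, h1 _ (by omega), ih]

/-- From time `s + X` on, passing through `b` after `s` steps is optimal, so row `a` is a multiple
of row `b` delayed by `s`. To see this, prepend to a walk from `a` a return from `b` to `a` whose
length completes `s` to a multiple of the period of row `b`. -/
theorem RowPeriodicFrom.of_critWalk (hM : ClosedLeOne M) {s X : ℕ} {a b : ι}
    (h : CritWalk M s a b) (hb : RowPeriodicFrom M b X) : RowPeriodicFrom M a (s + X) := by
  obtain ⟨p, hp, hper⟩ := hb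
  obtain ⟨s', ⟨m, hm⟩, hs⟩ := h.exists_return_dvd hM hp
  have key : ∀ t, X ≤ t → ∀ j, maxPow M (s + t) a j = maxPow M s a b * maxPow M t b j := by
    intro t ht j
    refine le_antisymm ?_ (le_maxPow_add M s t a b j)
    have h1 : maxPow M s' b a * maxPow M (s + t) a j ≤ maxPow M t b j := by
      rw [← maxPow_add_mul_period hper m ht j, mul_comm m p, ← hm, add_assoc]
      exact le_maxPow_add M s' (s + t) b a j
    calc maxPow M (s + t) a j
        = maxPow M s a b * (maxPow M s' b a * maxPow M (s + t) a j) := by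
          rw [← mul_assoc, hs, one_mul]
      _ ≤ _ := mul_le_mul_right h1 _
  refine ⟨p, hp, fun j => ?_⟩
  rw [show p + (s + X) = s + (p + X) by ring, key _ (by omega), key _ le_rfl, hper]

end Square

/-! ### Critical components, loops of powers and shortest critical cycles -/

/-- The nodes reached from `a` by critical walks. -/
def critNodes {ι : Type*} [Fintype ι] [DecidableEq ι] (M : Matrix ι ι ℝ≥0) (a : ι) : Set ι :=
  {b | ∃ s, CritWalk M s a b}

/-- The lengths of the nonempty closed walks of weight one based at the nodes reached from `a` by
critical walks. -/
def critLengths {ι : Type*} [Fintype ι] [DecidableEq ι] (M : Matrix ι ι ℝ≥0) (a : ι) : Set ℕ :=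
  {ℓ | 0 < ℓ ∧ ∃ b ∈ critNodes M a, maxPow M ℓ b b = 1}

section Square

variable {ι : Type*} [Fintype ι] [DecidableEq ι] {M : Matrix ι ι ℝ≥0}

theorem exists_walk_of_maxPow_ne_zero {t : ℕ} {i j : ι} (h : maxPow M t i j ≠ 0) :
    ∃ w : ℕ → ι, w 0 = i ∧ w t = j ∧ ∀ a b, a ≤ b → b ≤ t →
      maxPow M a i (w a) ≠ 0 ∧ maxPow M t i j ≤
        maxPow M a i (w a) * maxPow M (b - a) (w a) (w b) * maxPow M (t - b) (w b) j := by
  obtain ⟨w, hw0, hwt, hw⟩ := exists_walkWeight_eq h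
  refine ⟨w, hw0, hwt, fun a b hab hbt => ?_⟩
  have h1 : maxPow M t i j ≤
      maxPow M a i (w a) * maxPow M (b - a) (w a) (w b) * maxPow M (t - b) (w b) j := by
    obtain ⟨c, rfl⟩ := Nat.exists_eq_add_of_le hab
    obtain ⟨e, rfl⟩ := Nat.exists_eq_add_of_le hbt
    rw [← hw, walkWeight_add, walkWeight_add, ← hw0, ← hwt, Nat.add_sub_cancel_left,
      Nat.add_sub_cancel_left]
    exact mul_le_mul' (mul_le_mul' (walkWeight_le_maxPow M a w)
      (walkWeight_le_maxPow M c fun i => w (a + i)))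
      (walkWeight_le_maxPow M e fun i => w (a + c + i))
  refine ⟨fun h0 => h ?_, h1⟩
  rw [h0] at h1
  simpa using h1

/-- A walk that leaves only a set of at most `t` nodes to visit can be shortened. -/
theorem maxPow_le_maxPow_of_card_le (hM : ClosedLeOne M) {z : ι} (hz : M z z = 1) {S : Finset ι}
    (hS : ∀ t j, maxPow M t z j ≠ 0 → j ∈ S) {t : ℕ} (ht : S.card ≤ t + 1) (u : ℕ) (j : ι) :
    maxPow M u z j ≤ maxPow M t z j := by
  induction u using Nat.strong_induction_on with
  | _ u ih =>
    rcases le_or_gt u t with hu | hu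
    · obtain ⟨e, rfl⟩ := Nat.exists_eq_add_of_le hu
      have hloop : maxPow M e z z = 1 := by
        have : CritWalk M 1 z z := (critWalk_self_iff hM).2 (by rwa [maxPow_one])
        simpa using (critWalk_self_iff hM).1 (this.mul hM e)
      rw [add_comm]
      simpa [hloop] using le_maxPow_add M e u z z j
    · by_cases h0 : maxPow M u z j = 0
      · simp [h0]
      obtain ⟨w, -, -, hw⟩ := exists_walk_of_maxPow_ne_zero h0
      obtain ⟨a, ha, b, hb, hab, heq⟩ :
          ∃ a ∈ Finset.range (u + 1), ∃ b ∈ Finset.range (u + 1), a ≠ b ∧ w a = w b := by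
        refine Finset.exists_ne_map_eq_of_card_lt_of_maps_to (t := S) (by simp; omega) ?_
        intro a ha
        have ha' : a < u + 1 := by simpa using ha
        exact hS a _ (hw a a le_rfl (by omega)).1
      wlog hlt : a < b generalizing a b
      · exact this b hb a ha hab.symm heq.symm (by omega)
      rw [Finset.mem_range] at ha hb
      refine (hw a b hlt.le (by omega)).2.trans ?_
      rw [← heq]
      calc _ ≤ maxPow M a z (w a) * 1 * maxPow M (u - b) (w a) j :=
            mul_le_mul_left (mul_le_mul_right (hM _ _) _) _
        _ ≤ maxPow M (a + (u - b)) z j := by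
            rw [mul_one]; exact le_maxPow_add M _ _ _ _ _
        _ ≤ _ := ih _ (by omega)

theorem ClosedLeOne.maxPow (hM : ClosedLeOne M) (g : ℕ) : ClosedLeOne (maxPow M g) := by
  intro t i
  rw [← maxPow_mul]
  exact hM _ _

/-- In `maxPow M g` the node `z` has a loop of weight one, so its row no longer changes once the
number of steps reaches `S.card - 1`. Only nodes reached in multiples of `g` steps count, which is
what allows `S` to be a single cyclic class. -/
theorem rowPeriodicFrom_of_loop (hM : ClosedLeOne M) {g : ℕ} (hg : 0 < g) {z : ι}
    (hz : maxPow M g z z = 1) {S : Finset ι}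
    (hS : ∀ t j, maxPow M (g * t) z j ≠ 0 → j ∈ S) :
    RowPeriodicFrom M z ((S.card - 1) * g) := by
  refine ⟨g, hg, fun j => ?_⟩
  have hS' : ∀ t j, maxPow (maxPow M g) t z j ≠ 0 → j ∈ S := fun t j h =>
    hS t j (by rwa [maxPow_mul])
  have key := fun u v (hv : S.card ≤ v + 1) =>
    maxPow_le_maxPow_of_card_le (hM.maxPow g) hz hS' hv u j
  rw [show g + (S.card - 1) * g = g * (S.card - 1 + 1) by ring, mul_comm _ g, maxPow_mul,
    maxPow_mul]
  exact le_antisymm (key _ _ (by omega)) (key _ _ (by omega))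

/-- A shortest critical walk from `a` to the shortest critical cycles, followed by one of them. -/
theorem exists_lollipop (hM : ClosedLeOne M) {a : ι} {g : ℕ} (hg : IsLeast (critLengths M a) g) :
    ∃ (s : ℕ) (v : ℕ → ι), Set.InjOn v (Set.Iio (s + g)) ∧
      (∀ i < s + g, CritWalk M i a (v i)) ∧
      ∀ i, s ≤ i → i < s + g → maxPow M g (v i) (v i) = 1 := by
  classical
  obtain ⟨⟨hg0, y, ⟨s, hs⟩, hy⟩, hmin⟩ := hg
  have hex : ∃ s y, CritWalk M s a y ∧ maxPow M g y y = 1 := ⟨s, y, hs, hy⟩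
  clear! y s
  obtain ⟨s, ⟨y, hs, hy⟩, hsmin⟩ : ∃ s, (∃ y, CritWalk M s a y ∧ maxPow M g y y = 1) ∧
      ∀ s' < s, ¬ ∃ y, CritWalk M s' a y ∧ maxPow M g y y = 1 :=
    ⟨Nat.find hex, Nat.find_spec hex, fun s' h => Nat.find_min hex h⟩
  obtain ⟨x, hx0, hxs, hx⟩ := hs.exists_walk hM
  obtain ⟨c, hc0, hcg, hc⟩ := ((critWalk_self_iff hM).2 hy).exists_walk hM
  have hca : ∀ i ≤ g, CritWalk M (s + i) a (c i) := fun i hi =>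
    hs.trans hM (by simpa [hc0] using hc 0 i (Nat.zero_le _) hi)
  have hcc : ∀ i ≤ g, maxPow M g (c i) (c i) = 1 := by
    intro i hi
    rw [← critWalk_self_iff hM]
    have h1 := hc 0 i (Nat.zero_le _) hi
    have h2 := hc i g hi le_rfl
    rw [hc0] at h1
    rw [hcg] at h2
    have := h2.trans hM h1
    rwa [Nat.sub_zero, Nat.sub_add_cancel hi] at this
  have hxa : ∀ i ≤ s, CritWalk M i a (x i) := fun i hi => by
    simpa [hx0] using hx 0 i (Nat.zero_le _) hi
  refine ⟨s, fun i => if i < s then x i else c (i - s), ?_, ?_, ?_⟩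
  · have key : ∀ i j, i < j → j < s + g →
        (if i < s then x i else c (i - s)) ≠ (if j < s then x j else c (j - s)) := by
      intro i j hij hj heq
      by_cases hjs : j < s
      · rw [if_pos hjs, if_pos (hij.trans hjs)] at heq
        have h1 := (hxa i (by omega)).trans hM (heq ▸ hx j s hjs.le le_rfl)
        rw [hxs] at h1
        exact hsmin _ (by omega) ⟨y, h1, hy⟩
      · rw [if_neg hjs] at heq
        by_cases his : i < s
        · rw [if_pos his] at heq
          exact hsmin i his ⟨x i, hxa i his.le, heq ▸ hcc (j - s) (by omega)⟩
        · rw [if_neg his] at heq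
          have h1 := hc (i - s) (j - s) (by omega) (by omega)
          rw [← heq, critWalk_self_iff hM] at h1
          have := hmin ⟨by omega, c (i - s), ⟨_, hca (i - s) (by omega)⟩, h1⟩
          omega
    intro i hi j hj heq
    rcases lt_trichotomy i j with h | h | h
    · exact (key i j h hj heq).elim
    · exact h
    · exact (key j i h hi heq.symm).elim
  · intro i hi
    by_cases his : i < s
    · simpa [his] using hxa i his.le
    · have := hca (i - s) (by omega)
      rw [Nat.add_sub_cancel' (by omega)] at this
      simpa [his] using this
  · intro i hi hi'
    simpa [hi.not_gt] using hcc (i - s) (by omega)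

theorem ncard_critNodes_ge {a : ι} {n : ℕ} {v : ℕ → ι} (hv : Set.InjOn v (Set.Iio n))
    (hva : ∀ i < n, CritWalk M i a (v i)) : n ≤ (critNodes M a).ncard := by
  have h : (v '' Set.Iio n).ncard = n := by
    rw [hv.ncard_image, ← Finset.coe_Iio, Set.ncard_coe_finset, Nat.card_Iio]
  rw [← h]
  refine Set.ncard_le_ncard ?_ (Set.toFinite _)
  rintro _ ⟨i, hi, rfl⟩
  exact ⟨i, hva i hi⟩

end Square

/-! ### Zero-sum-free families -/

/-- The sums of the subfamilies of `δ` indexed by subsets of `J`. -/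
def subsums {G κ : Type*} [AddCommGroup G] [DecidableEq G] (δ : κ → G) (J : Finset κ) : Finset G :=
  J.powerset.image fun I => ∑ i ∈ I, δ i

/-- No nonempty subfamily sums to zero. -/
def ZeroSumFree {G κ : Type*} [AddCommGroup G] (δ : κ → G) (J : Finset κ) : Prop :=
  ∀ I ⊆ J, I.Nonempty → ∑ i ∈ I, δ i ≠ 0

theorem ZeroSumFree.subset {G κ : Type*} [AddCommGroup G] {δ : κ → G} {J K : Finset κ} (h : ZeroSumFree δ K) (hJ : J ⊆ K) :
    ZeroSumFree δ J := fun I hI => h I (hI.trans hJ)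

section ZeroSumFree

variable {G κ : Type*} [AddCommGroup G] [Fintype G] [DecidableEq G] [DecidableEq κ]

/-- If `x` produced no new subsum, the set of subsums would be stable under translation by `δ x` and
would contain every multiple of it, in particular `-δ x`. A subfamily of `J` with that sum, together
with `x`, sums to zero. -/
theorem card_subsums_lt_insert {δ : κ → G} {J : Finset κ} {x : κ} (hx : x ∉ J)
    (h : ZeroSumFree δ (insert x J)) :
    (subsums δ J).card < (subsums δ (insert x J)).card := by
  refine Finset.card_lt_card (Finset.ssubset_iff_subset_ne.2 ⟨?_, fun heq => ?_⟩)
  · exact Finset.image_subset_image (Finset.powerset_mono.2 (Finset.subset_insert x J))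
  have hstep : ∀ s ∈ subsums δ J, δ x + s ∈ subsums δ J := by
    intro s hs
    obtain ⟨I, hI, rfl⟩ := Finset.mem_image.1 hs
    rw [Finset.mem_powerset] at hI
    rw [heq]
    exact Finset.mem_image.2 ⟨insert x I, Finset.mem_powerset.2 (Finset.insert_subset_insert x hI),
      Finset.sum_insert fun hxI => hx (hI hxI)⟩
  have hall : ∀ n : ℕ, n • δ x ∈ subsums δ J := by
    intro n
    induction n with
    | zero => exact Finset.mem_image.2 ⟨∅, by simp, by simp⟩
    | succ n ih => rw [succ_nsmul']; exact hstep _ ih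
  obtain ⟨I, hI, hsum⟩ := Finset.mem_image.1 (hall (Fintype.card G - 1))
  rw [Finset.mem_powerset] at hI
  refine h (insert x I) (Finset.insert_subset_insert x hI) (Finset.insert_nonempty x I) ?_
  rw [Finset.sum_insert fun hxI => hx (hI hxI)]
  rw [hsum, ← succ_nsmul', Nat.sub_add_cancel Fintype.card_pos, card_nsmul_eq_zero]

theorem card_add_card_subsums_le {δ : κ → G} {D J : Finset κ} (hd : Disjoint D J)
    (h : ZeroSumFree δ (D ∪ J)) :
    D.card + (subsums δ J).card ≤ (subsums δ (D ∪ J)).card := by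
  induction D using Finset.induction_on with
  | empty => simp
  | insert x D hx ih =>
    rw [Finset.disjoint_insert_left] at hd
    rw [Finset.insert_union] at h ⊢
    have h1 := ih hd.2 (h.subset (Finset.subset_insert x _))
    have h2 := card_subsums_lt_insert (by simp [hx, hd.1]) h
    rw [Finset.card_insert_of_notMem hx]
    omega

theorem ZeroSumFree.card_lt {δ : κ → G} {J : Finset κ} (h : ZeroSumFree δ J) :
    J.card < Fintype.card G := by
  have h1 := card_add_card_subsums_le (Finset.disjoint_empty_right J) (by simpa using h)
  have h2 : (subsums δ (∅ : Finset κ)).card = 1 := by simp [subsums]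
  have h3 := Finset.card_le_univ (subsums δ J)
  rw [Finset.union_empty] at h1
  omega

/-- A zero-sum-free family of the maximal length in a cyclic group is constant. -/
theorem ZeroSumFree.card_add_one_lt {δ : κ → G} {J : Finset κ} (h : ZeroSumFree δ J) {a b : κ}
    (ha : a ∈ J) (hb : b ∈ J) (hab : δ a ≠ δ b) : J.card + 1 < Fintype.card G := by
  have hne : a ≠ b := fun he => hab (by rw [he])
  have hsub : {a, b} ⊆ J := Finset.insert_subset ha (Finset.singleton_subset_iff.2 hb)
  have h1 := card_add_card_subsums_le Finset.sdiff_disjoint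
    (by rwa [Finset.sdiff_union_of_subset hsub])
  rw [Finset.sdiff_union_of_subset hsub, Finset.card_sdiff_of_subset hsub] at h1
  have h3 := Finset.card_le_univ (subsums δ J)
  have ha0 : δ a ≠ 0 := by
    simpa using h {a} (Finset.singleton_subset_iff.2 ha) (Finset.singleton_nonempty a)
  have hb0 : δ b ≠ 0 := by
    simpa using h {b} (Finset.singleton_subset_iff.2 hb) (Finset.singleton_nonempty b)
  have hab0 : δ a + δ b ≠ 0 := by
    simpa [Finset.sum_pair hne] using h {a, b} hsub (Finset.insert_nonempty _ _)
  -- Two distinct values already give four subsums, one more than two elements are guaranteed to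
  -- give.
  have h4 : ({0, δ a, δ b, δ a + δ b} : Finset G) ⊆ subsums δ {a, b} := by
    intro x hx
    simp only [Finset.mem_insert, Finset.mem_singleton] at hx
    rw [subsums, Finset.mem_image]
    rcases hx with rfl | rfl | rfl | rfl
    · exact ⟨∅, by simp, by simp⟩
    · exact ⟨{a}, by simp, by simp⟩
    · exact ⟨{b}, by simp, by simp⟩
    · exact ⟨{a, b}, by simp, Finset.sum_pair hne⟩
  have h5 : ({0, δ a, δ b, δ a + δ b} : Finset G).card = 4 := by
    rw [Finset.card_insert_of_notMem, Finset.card_insert_of_notMem, Finset.card_pair]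
    · simpa using ha0
    · simp [hab, hb0]
    · simp [ha0.symm, hb0.symm, hab0.symm]
  have h6 := Finset.card_le_card h4
  have h7 := Finset.card_pair hne
  omega

end ZeroSumFree

/-! ### Matrices with a critical Hamiltonian cycle -/

section Hamiltonian

variable {m : ℕ} [NeZero m] {N : Matrix (ZMod m) (ZMod m) ℝ≥0}

theorem exists_lt_add_eq (a u : ZMod m) : ∃ w < m, a + (w : ZMod m) = u :=
  ⟨(u - a).val, ZMod.val_lt _, by rw [ZMod.natCast_zmod_val]; abel⟩

theorem one_le_maxPow_of_cycle (hc : ∀ a, N a (a + 1) = 1) (w : ℕ) (a : ZMod m) :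
    1 ≤ maxPow N w a (a + w) := by
  induction w with
  | zero => simp [maxPow_zero]
  | succ w ih =>
    have := le_maxMul (maxPow N w) N a (a + w) (a + w + 1)
    rw [hc, mul_one] at this
    rw [maxPow_succ, Nat.cast_succ, ← add_assoc]
    exact ih.trans this

/-- Each jump costs at most `m - 1` steps along the cycle to its starting node and one step for
itself; the remaining time is spent on the cycle. The end point depends only on the sum of the jumps
and on the time, so the order of the jumps is irrelevant. -/
theorem prod_le_maxPow_of_cycle (hc : ∀ a, N a (a + 1) = 1) {κ : Type*} [DecidableEq κ]
    (u δ : κ → ZMod m) (J : Finset κ) (k : ZMod m) {t : ℕ} (ht : J.card * m ≤ t) :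
    ∏ i ∈ J, N (u i) (u i + 1 + δ i) ≤ maxPow N t k (k + ∑ i ∈ J, δ i + t) := by
  induction J using Finset.induction_on generalizing k t with
  | empty => simpa using one_le_maxPow_of_cycle hc t k
  | insert x J hx ih =>
    rw [Finset.card_insert_of_notMem hx, Nat.succ_mul] at ht
    obtain ⟨w, hw, hwu⟩ := exists_lt_add_eq k (u x)
    obtain ⟨e, rfl⟩ := Nat.exists_eq_add_of_le (show w + 1 ≤ t by omega)
    rw [Finset.prod_insert hx, Finset.sum_insert hx, ← one_mul (N _ _ * _), ← mul_assoc]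
    have h1 := one_le_maxPow_of_cycle hc w k
    rw [hwu] at h1
    have h2 := ih (u x + 1 + δ x) (t := e) (by omega)
    have h3 : k + (δ x + ∑ i ∈ J, δ i) + ((w + 1 + e : ℕ) : ZMod m)
        = u x + 1 + δ x + ∑ i ∈ J, δ i + e := by
      rw [← hwu]; push_cast; ring
    rw [h3]
    calc _ ≤ maxPow N w k (u x) * N (u x) (u x + 1 + δ x) *
            maxPow N e (u x + 1 + δ x) (u x + 1 + δ x + ∑ i ∈ J, δ i + e) :=
          mul_le_mul' (mul_le_mul_left h1 _) h2
      _ ≤ _ := (mul_le_mul_left (le_maxMul (maxPow N w) N _ _ _) _).trans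
          (le_maxPow_add N (w + 1) e _ _ _)

/-- Repeating one jump is cheaper than making different ones: since `δ ≠ 0`, returning to `u` takes
at most `m - 2` steps along the cycle. -/
theorem pow_le_maxPow_of_cycle (hc : ∀ a, N a (a + 1) = 1) (u : ZMod m) {δ : ZMod m}
    (hδ : δ ≠ 0) (q : ℕ) {t : ℕ} (ht : q * (m - 1) + 1 ≤ t) :
    N u (u + 1 + δ) ^ (q + 1) ≤ maxPow N t u (u + (q + 1) • δ + t) := by
  induction q generalizing t with
  | zero =>
    obtain ⟨e, rfl⟩ := Nat.exists_eq_add_of_le (show 1 ≤ t by omega)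
    have h1 := one_le_maxPow_of_cycle hc e (u + 1 + δ)
    have h2 := le_maxPow_add N 1 e u (u + 1 + δ) (u + 1 + δ + e)
    rw [maxPow_one] at h2
    have h3 : u + (0 + 1) • δ + ((1 + e : ℕ) : ZMod m) = u + 1 + δ + e := by
      push_cast; rw [one_smul]; ring
    rw [h3, zero_add, pow_one]
    exact (le_mul_of_one_le_right' h1).trans h2
  | succ q ih =>
    obtain ⟨w, hw, hwu⟩ := exists_lt_add_eq (u + 1 + δ) u
    -- A return in exactly `m - 1` steps would mean that the jump was an edge of the cycle.
    have hw' : w + 1 < m := by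
      refine lt_of_le_of_ne hw fun he => hδ ?_
      have : ((w + 1 : ℕ) : ZMod m) = 0 := by rw [he]; exact ZMod.natCast_self m
      push_cast at this
      have h4 : u + (δ + ((w : ZMod m) + 1)) = u + 0 := by
        rw [add_zero]; nth_rewrite 2 [← hwu]; ring
      rwa [this, add_zero, add_right_inj] at h4
    rw [Nat.succ_mul] at ht
    obtain ⟨e, rfl⟩ := Nat.exists_eq_add_of_le (show 1 + w ≤ t by omega)
    have h1 := one_le_maxPow_of_cycle hc w (u + 1 + δ)
    rw [hwu] at h1
    have h2 := ih (t := e) (by omega)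
    have h3 : u + (q + 1 + 1) • δ + ((1 + w + e : ℕ) : ZMod m) = u + (q + 1) • δ + e := by
      nth_rewrite 2 [← hwu]
      rw [succ_nsmul δ (q + 1)]; push_cast; ring
    rw [h3, pow_succ']
    refine (mul_le_mul' (le_mul_of_one_le_right' h1) h2).trans ?_
    have h5 := le_maxPow_add N 1 w u (u + 1 + δ) u
    rw [maxPow_one] at h5
    exact (mul_le_mul_left h5 _).trans (le_maxPow_add N (1 + w) e _ _ _)

/-- A walk ends at its start plus its jumps plus its length modulo `m`. Discarding jumps that sum to
zero keeps the end point and does not decrease the weight, as all entries are at most one. The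
remaining family is zero-sum-free, so it has at most `m - 1` members. -/
theorem maxPow_le_of_cycle (hm : 2 ≤ m) (h1 : ∀ a b, N a b ≤ 1) (hc : ∀ a, N a (a + 1) = 1)
    {t u : ℕ} (htu : (u : ZMod m) = t) (ht : (m - 1) ^ 2 + 1 ≤ t) (k j : ZMod m) :
    maxPow N u k j ≤ maxPow N t k j := by
  classical
  by_cases h0 : maxPow N u k j = 0
  · simp [h0]
  obtain ⟨x, hx0, hxu, hx⟩ := exists_walkWeight_eq h0
  set δ : ℕ → ZMod m := fun i => x (i + 1) - x i - 1 with hδ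
  have hxδ : ∀ i, x i + 1 + δ i = x (i + 1) := fun i => by simp only [hδ]; ring
  have hsum : ∀ n, x n = x 0 + ∑ i ∈ Finset.range n, δ i + n := by
    intro n
    induction n with
    | zero => simp
    | succ n ih => rw [Finset.sum_range_succ, ← hxδ, ih]; push_cast; ring
  have hj : ∀ J : Finset ℕ, ∑ i ∈ J, δ i = ∑ i ∈ Finset.range u, δ i →
      k + ∑ i ∈ J, δ i + t = j := by
    intro J hJ
    rw [hJ, ← hx0, ← hxu, hsum u, htu]
  -- a smallest subfamily of the jumps with the same sum
  obtain ⟨J, hJ, hJmin⟩ := Finset.exists_min_image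
    ((Finset.range u).powerset.filter fun J => ∑ i ∈ J, δ i = ∑ i ∈ Finset.range u, δ i)
    Finset.card ⟨Finset.range u, by simp⟩
  rw [Finset.mem_filter, Finset.mem_powerset] at hJ
  have hzsf : ZeroSumFree δ J := by
    intro I hI hIne hI0
    have hs : ∑ i ∈ J \ I, δ i = ∑ i ∈ Finset.range u, δ i := by
      rw [← hJ.2, ← Finset.sum_sdiff hI, hI0, add_zero]
    have h2 := hJmin (J \ I) (Finset.mem_filter.2
      ⟨Finset.mem_powerset.2 (Finset.sdiff_subset.trans hJ.1), hs⟩)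
    rw [Finset.card_sdiff_of_subset hI] at h2
    have h3 := Finset.card_pos.2 hIne
    have h4 := Finset.card_le_card hI
    omega
  have hval : maxPow N u k j ≤ ∏ i ∈ J, N (x i) (x i + 1 + δ i) := by
    rw [← hx, walkWeight, ← Finset.prod_sdiff hJ.1]
    simp only [hxδ]
    exact mul_le_of_le_one_left' (Finset.prod_le_one' fun i _ => h1 _ _)
  obtain ⟨n, rfl⟩ : ∃ n, m = n + 2 := ⟨m - 2, by omega⟩
  have hlt := hzsf.card_lt
  rw [ZMod.card] at hlt
  refine hval.trans ?_
  rw [← hj J hJ.2]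
  -- With at most `m - 2` jumps, the crude cost `(m - 2) * m = (m - 1) ^ 2 - 1` suffices.
  by_cases hcard : J.card + 1 < n + 2
  · refine prod_le_maxPow_of_cycle hc x δ J k ?_
    have : J.card * (n + 2) ≤ n * (n + 2) := Nat.mul_le_mul_right _ (by omega)
    have h5 : (n + 2 - 1) ^ 2 + 1 = n * (n + 2) + 2 := by
      rw [show n + 2 - 1 = n + 1 by omega]; ring
    omega
  -- With `m - 1` jumps the crude cost is too large, but all jumps have the same displacement and
  -- can be replaced by copies of a heaviest one. The time is then at most `m - 1` steps to its
  -- start and `(m - 2) * (m - 1) + 1` for the copies.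
  · have hJn : J.card = n + 1 := by omega
    have hJne : J.Nonempty := Finset.card_pos.1 (by omega)
    obtain ⟨b, hb, hbmax⟩ := Finset.exists_max_image J (fun i => N (x i) (x i + 1 + δ i)) hJne
    have hconst : ∀ i ∈ J, δ i = δ b := by
      intro i hi
      by_contra hne
      have := hzsf.card_add_one_lt hi hb hne
      rw [ZMod.card] at this
      omega
    have hδb : δ b ≠ 0 := by
      simpa using hzsf {b} (Finset.singleton_subset_iff.2 hb) (Finset.singleton_nonempty b)
    refine (Finset.prod_le_pow_card J _ _ hbmax).trans ?_
    rw [Finset.sum_congr rfl hconst, Finset.sum_const, hJn]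
    obtain ⟨w, hw, hwu⟩ := exists_lt_add_eq k (x b)
    have h5 : (n + 2 - 1) ^ 2 + 1 = n * (n + 1) + (n + 1) + 1 := by
      rw [show n + 2 - 1 = n + 1 by omega]; ring
    obtain ⟨e, rfl⟩ := Nat.exists_eq_add_of_le (show w ≤ t by
      have := Nat.zero_le (n * (n + 1)); omega)
    have h6 := pow_le_maxPow_of_cycle hc (x b) hδb n (t := e) (by
      rw [show n + 2 - 1 = n + 1 by omega]; omega)
    have h7 := one_le_maxPow_of_cycle hc w k
    rw [hwu] at h7
    have h8 : k + (n + 1) • δ b + ((w + e : ℕ) : ZMod (n + 2)) = x b + (n + 1) • δ b + e := by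
      rw [← hwu]; push_cast; ring
    rw [h8]
    exact (h6.trans (le_mul_of_one_le_left' h7)).trans (le_maxPow_add N w e _ _ _)

end Hamiltonian

/-! ### Scaling a critical Hamiltonian cycle, and the Wielandt bound for rows -/

section Square

variable {ι : Type*} [Fintype ι] [DecidableEq ι] {M : Matrix ι ι ℝ≥0}

/-- The scaling of the critical Hamiltonian cycle `w` to unit weights, indexed by `ZMod m`. -/
noncomputable def scaledCycle (M : Matrix ι ι ℝ≥0) (w : ℕ → ι) (m : ℕ) :
    Matrix (ZMod m) (ZMod m) ℝ≥0 :=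
  Matrix.of fun a b =>
    walkWeight M a.val w * M (w a.val) (w b.val) * (walkWeight M b.val w)⁻¹

theorem walkWeight_le_maxPow_sub (M : Matrix ι ι ℝ≥0) {i j : ℕ} (hij : i ≤ j) (w : ℕ → ι) :
    ∃ c ≤ maxPow M (j - i) (w i) (w j), walkWeight M j w = walkWeight M i w * c := by
  obtain ⟨e, rfl⟩ := Nat.exists_eq_add_of_le hij
  refine ⟨_, ?_, walkWeight_add M i e w⟩
  rw [Nat.add_sub_cancel_left]
  exact walkWeight_le_maxPow M e fun x => w (i + x)

theorem walkWeight_ne_zero_of_le {m : ℕ} {w : ℕ → ι} (hw : walkWeight M m w = 1) {i : ℕ}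
    (hi : i ≤ m) : walkWeight M i w ≠ 0 := by
  obtain ⟨c, -, hc⟩ := walkWeight_le_maxPow_sub M hi w
  intro h0
  rw [hw, h0, zero_mul] at hc
  exact one_ne_zero hc

theorem maxPow_eq_one_of_repeat (hM : ClosedLeOne M) {m : ℕ} {w : ℕ → ι}
    (hw : walkWeight M m w = 1) (hwm : w m = w 0) {i j : ℕ} (hij : i ≤ j) (hj : j ≤ m)
    (heq : w i = w j) : maxPow M (j - i) (w i) (w i) = 1 := by
  obtain ⟨c, hc, hc'⟩ := walkWeight_le_maxPow_sub M hij w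
  obtain ⟨e, he, he'⟩ := walkWeight_le_maxPow_sub M hj w
  rw [← heq] at hc he
  rw [hwm] at he
  refine le_antisymm (hM _ _) (le_trans ?_ hc)
  calc (1 : ℝ≥0) = walkWeight M i w * e * c := by rw [← hw, he', hc']; ring
    _ ≤ 1 * c := by
      refine mul_le_mul_left ?_ c
      refine (mul_le_mul' (walkWeight_le_maxPow M i w) he).trans ?_
      exact (le_maxPow_add M _ _ _ _ _).trans (hM _ _)
    _ = c := one_mul c

/-- The chord from `w i` to `w j`, completed to a closed walk by a piece of the cycle, has weight at
most one. If `i ≤ j`, the completion passes through the base point `w 0`. -/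
theorem walkWeight_mul_entry_le (hM : ClosedLeOne M) {m : ℕ} {w : ℕ → ι}
    (hw : walkWeight M m w = 1) (hwm : w m = w 0) {i j : ℕ} (hj : j ≤ m) :
    walkWeight M i w * M (w i) (w j) ≤ walkWeight M j w := by
  rcases le_total j i with h | h
  · obtain ⟨c, hc, hc'⟩ := walkWeight_le_maxPow_sub M h w
    rw [hc', mul_assoc]
    refine mul_le_of_le_one_right' ((mul_le_mul_left hc _).trans ?_)
    exact (le_maxMul _ _ _ _ _).trans (hM (i - j + 1) _)
  · obtain ⟨c, hc, hc'⟩ := walkWeight_le_maxPow_sub M hj w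
    rw [hwm] at hc
    calc walkWeight M i w * M (w i) (w j)
        = walkWeight M j w * (walkWeight M i w * M (w i) (w j) * c) := by
          rw [mul_comm _ c, ← mul_assoc, ← hc', hw, one_mul]
      _ ≤ walkWeight M j w * 1 := by
          refine mul_le_mul_right ?_ _
          refine (mul_le_mul' (mul_le_mul_left (walkWeight_le_maxPow M i w) _) hc).trans ?_
          refine (mul_le_mul_left (le_maxMul (maxPow M i) M _ _ _) _).trans ?_
          exact (le_maxPow_add M (i + 1) _ _ _ _).trans (hM _ _)
      _ = _ := mul_one _

section Scaled

variable {m : ℕ} [NeZero m] {w : ℕ → ι}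

theorem scaledCycle_le_one (hM : ClosedLeOne M) (hw : walkWeight M m w = 1) (hwm : w m = w 0)
    (a b : ZMod m) : scaledCycle M w m a b ≤ 1 := by
  have hb := walkWeight_ne_zero_of_le hw (ZMod.val_lt b).le
  rw [scaledCycle, Matrix.of_apply, ← mul_inv_cancel₀ hb]
  exact mul_le_mul_left (walkWeight_mul_entry_le hM hw hwm (ZMod.val_lt b).le) _

theorem scaledCycle_add_one (hw : walkWeight M m w = 1) (hwm : w m = w 0) (a : ZMod m) :
    scaledCycle M w m a (a + 1) = 1 := by
  have hsucc : walkWeight M (a.val + 1) w = walkWeight M a.val w * M (w a.val) (w (a.val + 1)) :=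
    Finset.prod_range_succ _ _
  have hne : walkWeight M (a.val + 1) w ≠ 0 := walkWeight_ne_zero_of_le hw (ZMod.val_lt a)
  have hval : (a + 1).val = (a.val + 1) % m := by
    rw [← ZMod.val_natCast, Nat.cast_succ, ZMod.natCast_zmod_val]
  have hmod : w ((a.val + 1) % m) = w (a.val + 1) ∧
      walkWeight M ((a.val + 1) % m) w = walkWeight M (a.val + 1) w := by
    rcases (Nat.succ_le_of_lt (ZMod.val_lt a)).lt_or_eq with h | h
    · rw [Nat.mod_eq_of_lt h]; exact ⟨rfl, rfl⟩
    · rw [Nat.succ_eq_add_one] at h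
      rw [h, Nat.mod_self, hw, hwm]
      exact ⟨rfl, by simp [walkWeight]⟩
  rw [scaledCycle, Matrix.of_apply, hval, hmod.1, hmod.2, ← hsucc, mul_inv_cancel₀ hne]

/-- The scaling is a diagonal similarity, so it commutes with powers. Time 0 is excluded because `w`
is not assumed injective: distinct indices may denote the same node. -/
theorem maxPow_scaledCycle (hw : walkWeight M m w = 1)
    (hS : ∀ t j, maxPow M t (w 0) j ≠ 0 → ∃ b : ZMod m, w b.val = j) (t : ℕ) (b : ZMod m) :
    maxPow (scaledCycle M w m) t 0 b = maxPow M t (w 0) (w b.val) * (walkWeight M b.val w)⁻¹ ∨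
      t = 0 := by
  induction t generalizing b with
  | zero => exact Or.inr rfl
  | succ t ih =>
    left
    have hpos : ∀ c : ZMod m, walkWeight M c.val w ≠ 0 := fun c =>
      walkWeight_ne_zero_of_le hw (ZMod.val_lt c).le
    have h00 : walkWeight M (0 : ZMod m).val w = 1 := by simp [walkWeight]
    rcases Nat.eq_zero_or_pos t with rfl | ht
    · rw [zero_add, maxPow_one, maxPow_one, scaledCycle, Matrix.of_apply, h00, one_mul,
        ZMod.val_zero]
    have ih' : ∀ c : ZMod m, maxPow (scaledCycle M w m) t 0 c * scaledCycle M w m c b =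
        maxPow M t (w 0) (w c.val) * M (w c.val) (w b.val) * (walkWeight M b.val w)⁻¹ := by
      intro c
      rw [(ih c).resolve_right ht.ne', scaledCycle, Matrix.of_apply]
      have := hpos c
      field_simp
    rw [maxPow_succ, maxPow_succ]
    apply le_antisymm
    · refine maxMul_le fun c => ?_
      rw [ih' c]
      exact mul_le_mul_left (le_maxMul (maxPow M t) M _ _ _) _
    · by_cases h0 : maxMul (maxPow M t) M (w 0) (w b.val) = 0
      · simp [h0]
      · obtain ⟨y, hy⟩ := exists_maxMul_eq h0
        obtain ⟨c, rfl⟩ := hS t y fun h => h0 (by rw [← hy, h, zero_mul])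
        rw [← hy, ← ih' c]
        exact le_maxMul (maxPow (scaledCycle M w m) t) (scaledCycle M w m) _ _ _

end Scaled

/-- The row of a node of a critical cycle through all nodes reached from it. -/
theorem rowPeriodicFrom_of_hamiltonian (hM : ClosedLeOne M) {z : ι} {S : Finset ι}
    (hS : ∀ t j, maxPow M t z j ≠ 0 → j ∈ S) (hcard : 2 ≤ S.card)
    (hz : maxPow M S.card z z = 1)
    (hmin : ∀ ℓ ∈ critLengths M z, S.card ≤ ℓ) :
    RowPeriodicFrom M z ((S.card - 1) ^ 2 + 1) := by
  obtain ⟨w, rfl, hwm, hw⟩ := exists_walkWeight_eq (hz.trans_ne one_ne_zero)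
  rw [hz] at hw
  set m := S.card with hm
  have : NeZero m := ⟨by omega⟩
  have hinj : Set.InjOn w (Finset.range m) := by
    have key : ∀ i j, i < j → j < m → w i ≠ w j := by
      intro i j hij hj heq
      -- A repeated node would cut off a critical closed walk shorter than `S.card`.
      have h1 := maxPow_eq_one_of_repeat hM hw hwm hij.le hj.le heq
      obtain ⟨c, hc, hc'⟩ := walkWeight_le_maxPow_sub M (hij.trans hj).le w
      rw [hwm] at hc
      have := hmin (j - i) ⟨by omega, w i, ⟨i, hM.critWalk (s' := m - i) ?_⟩, h1⟩
      · omega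
      · rw [← hw, hc']
        exact mul_le_mul' (walkWeight_le_maxPow M i w) hc
    intro i hi j hj heq
    rw [Finset.mem_coe, Finset.mem_range] at hi hj
    rcases lt_trichotomy i j with h | h | h
    · exact (key i j h hj heq).elim
    · exact h
    · exact (key j i h hi heq.symm).elim
  have himage : (Finset.range m).image w = S := by
    refine Finset.eq_of_subset_of_card_le ?_ ?_
    · intro y hy
      obtain ⟨i, hi, rfl⟩ := Finset.mem_image.1 hy
      rw [Finset.mem_range] at hi
      refine hS i _ fun h0 => walkWeight_ne_zero_of_le hw hi.le ?_
      exact le_antisymm (h0 ▸ walkWeight_le_maxPow M i w) zero_le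
    · rw [Finset.card_image_of_injOn hinj, Finset.card_range]
  have hS' : ∀ t j, maxPow M t (w 0) j ≠ 0 → ∃ b : ZMod m, w b.val = j := by
    intro t j h
    have h1 := hS t j h
    rw [← himage] at h1
    obtain ⟨i, hi, rfl⟩ := Finset.mem_image.1 h1
    exact ⟨(i : ZMod m), by rw [ZMod.val_cast_of_lt (Finset.mem_range.1 hi)]⟩
  refine ⟨m, by omega, fun j => le_antisymm ?_ ?_⟩
  · by_cases h0 : maxPow M (m + ((m - 1) ^ 2 + 1)) (w 0) j = 0
    · simp [h0]
    obtain ⟨b, rfl⟩ := hS' _ _ h0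
    have h1 := maxPow_le_of_cycle hcard (scaledCycle_le_one hM hw hwm)
      (scaledCycle_add_one hw hwm) (t := (m - 1) ^ 2 + 1) (u := m + ((m - 1) ^ 2 + 1))
      (by push_cast; simp) le_rfl 0 b
    rw [(maxPow_scaledCycle hw hS' _ b).resolve_right (by omega),
      (maxPow_scaledCycle hw hS' _ b).resolve_right (by omega)] at h1
    exact le_of_mul_le_mul_right h1
      (inv_pos.2 (pos_iff_ne_zero.2 (walkWeight_ne_zero_of_le hw (ZMod.val_lt b).le)))
  · simpa [hz] using le_maxPow_add M m ((m - 1) ^ 2 + 1) (w 0) (w 0) j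

/-- Walk to a shortest critical cycle, of length `g`. If it misses a node of `S`, the loop bound
plus the length of the approach is small enough; otherwise it is Hamiltonian on `S`. -/
theorem rowPeriodicFrom_wielandt (hM : ClosedLeOne M) {z : ι} {p : ℕ} (hp : 0 < p)
    (hz : maxPow M p z z = 1) {S : Finset ι} (hS : ∀ t j, maxPow M t z j ≠ 0 → j ∈ S) :
    RowPeriodicFrom M z (wielandt S.card) := by
  have hne : (critLengths M z).Nonempty := ⟨p, hp, z, ⟨0, CritWalk.refl M z⟩, hz⟩
  obtain ⟨g, hg⟩ : ∃ g, IsLeast (critLengths M z) g :=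
    ⟨sInf (critLengths M z), Nat.sInf_mem hne, fun _ h => Nat.sInf_le h⟩
  obtain ⟨s, v, hinj, hv, hvg⟩ := exists_lollipop hM hg
  have hg0 := hg.1.1
  have hsg : s + g ≤ S.card := by
    rw [← Finset.card_range (s + g)]
    refine Finset.card_le_card_of_injOn v ?_ (by simpa using hinj)
    intro i hi
    exact hS i _ (hv i (by simpa using hi)).ne_zero
  have hrow : RowPeriodicFrom M z (s + (S.card - 1) * g) := by
    refine RowPeriodicFrom.of_critWalk hM (hv s (by omega)) ?_
    refine rowPeriodicFrom_of_loop hM hg0 (hvg s le_rfl (by omega)) fun t j h => ?_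
    refine hS (s + g * t) j fun h0 => mul_ne_zero (hv s (by omega)).ne_zero h ?_
    exact le_antisymm (h0 ▸ le_maxPow_add M s (g * t) z (v s) j) zero_le
  rcases Nat.lt_or_ge S.card 2 with hc | hc
  · have : S.card = 1 := by omega
    have hs0 : s = 0 := by omega
    simpa [wielandt, this, hs0] using hrow
  rw [wielandt, if_neg (by omega)]
  rcases Nat.lt_or_ge g S.card with hgc | hgc
  · refine hrow.mono ?_
    -- With `S.card = n + 2` and `s ≤ n + 2 - g`, the time `s + (n + 1) * g` is at most `n + 2 + n *
    -- g`, and `g ≤ n + 1` gives `(n + 1) ^ 2 + 1`.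
    obtain ⟨n, hn⟩ : ∃ n, S.card = n + 2 := ⟨S.card - 2, by omega⟩
    rw [hn] at hsg hgc ⊢
    have h1 : n * g ≤ n * (n + 1) := Nat.mul_le_mul_left _ (by omega)
    rw [show n + 2 - 1 = n + 1 by omega]
    nlinarith
  · obtain rfl : s = 0 := by omega
    have hgS : g = S.card := by omega
    have hv0 : z = v 0 := critWalk_zero_iff.1 (hv 0 (by omega))
    have h1 := hvg 0 le_rfl (by omega)
    rw [← hv0, hgS] at h1
    exact rowPeriodicFrom_of_hamiltonian hM hS hc h1 fun ℓ hℓ => hgS ▸ hg.2 hℓ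

end Square

/-! ### Small classes in a partition into `d` cyclic classes -/

theorem injOn_add_natCast {d : ℕ} (c : ZMod d) {n : ℕ} (hn : n ≤ d) :
    Set.InjOn (fun s : ℕ => c + (s : ZMod d)) (Finset.range n) := by
  intro a ha b hb h
  rw [Finset.mem_coe, Finset.mem_range] at ha hb
  have h1 : (a : ZMod d) = b := add_left_cancel h
  have h2 := congrArg ZMod.val h1
  rwa [ZMod.val_cast_of_lt (by omega), ZMod.val_cast_of_lt (by omega)] at h2

theorem injOn_sub_natCast {d : ℕ} (c : ZMod d) {n : ℕ} (hn : n ≤ d) :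
    Set.InjOn (fun s : ℕ => c - (s : ZMod d)) (Finset.range n) := by
  intro a ha b hb h
  refine injOn_add_natCast 0 hn ha hb ?_
  simpa using h

section Classes

variable {d : ℕ} [NeZero d]

theorem card_le_mod_of_div_lt {f : ZMod d → ℕ} (hf : ∀ c, (∑ c, f c) / d ≤ f c)
    {F : Finset (ZMod d)} (hF : ∀ c ∈ F, (∑ c, f c) / d < f c) : F.card ≤ (∑ c, f c) % d := by
  set r := ∑ c, f c with hr
  have h1 : ∑ c : ZMod d, (r / d + if c ∈ F then 1 else 0) ≤ r := by
    nth_rewrite 2 [hr]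
    refine Finset.sum_le_sum fun c _ => ?_
    split_ifs with h
    · exact hF c h
    · exact hf c
  rw [Finset.sum_add_distrib, Finset.sum_const, Finset.card_univ, ZMod.card, smul_eq_mul,
    Finset.sum_ite_mem, Finset.univ_inter, Finset.sum_const, smul_eq_mul, mul_one] at h1
  have h2 := Nat.div_add_mod r d
  omega

/-- If no class lies below the integer part of the average, at most (total mod `d`) classes lie
above it, so among that many plus one consecutive classes from `c` one attains it. The number `s` is
the length of a walk from class `c` to the chosen class. -/
theorem exists_small_class (f : ZMod d → ℕ) (c : ZMod d) :
    (∃ s < d, f (c + s) < (∑ c, f c) / d) ∨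
      ((∀ c', (∑ c, f c) / d ≤ f c') ∧ ∃ s ≤ (∑ c, f c) % d, f (c + s) = (∑ c, f c) / d ∧
        ∀ s' < s, (∑ c, f c) / d < f (c + s')) := by
  classical
  by_cases hf : ∀ c', (∑ c, f c) / d ≤ f c'
  · right
    refine ⟨hf, ?_⟩
    have hlt := Nat.mod_lt (∑ c, f c) (NeZero.pos d)
    have hprefix : ∀ n ≤ d, (∀ s < n, (∑ c, f c) / d < f (c + s)) → n ≤ (∑ c, f c) % d := by
      intro n hn h
      have h1 := card_le_mod_of_div_lt hf
        (F := (Finset.range n).image fun s : ℕ => c + (s : ZMod d)) (by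
          intro c' hc'
          obtain ⟨s, hs, rfl⟩ := Finset.mem_image.1 hc'
          exact h s (Finset.mem_range.1 hs))
      rwa [Finset.card_image_of_injOn (injOn_add_natCast c hn), Finset.card_range] at h1
    have hex : ∃ s : ℕ, f (c + s) ≤ (∑ c, f c) / d := by
      by_contra! h
      exact absurd (hprefix d le_rfl fun s _ => h s) (by omega)
    refine ⟨Nat.find hex, ?_, le_antisymm (Nat.find_spec hex) (hf _),
      fun s' hs' => not_le.1 (Nat.find_min hex hs')⟩
    have h2 := hprefix (min (Nat.find hex) d) (min_le_right _ _) fun s hs =>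
      not_le.1 (Nat.find_min hex (lt_of_lt_of_le hs (min_le_left _ _)))
    omega
  · left
    push Not at hf
    obtain ⟨c', hc'⟩ := hf
    refine ⟨(c' - c).val, ZMod.val_lt _, ?_⟩
    rwa [ZMod.natCast_zmod_val, add_sub_cancel]

end Classes

/-- A class below the average thus saves at least `d` steps, which pays for walking to it.
Strictness needs `1 ≤ a`, as the values at 0 and 1 agree. -/
theorem wielandt_lt_wielandt {a b : ℕ} (ha : 1 ≤ a) (hab : a < b) : wielandt a < wielandt b := by
  unfold wielandt
  rw [if_neg (by omega : ¬ b ≤ 1)]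
  split_ifs
  · omega
  · have : (a - 1) ^ 2 < (b - 1) ^ 2 := Nat.pow_lt_pow_left (by omega) two_ne_zero
    omega

/-- The number of nodes in the class `c`. -/
def classSize {ρ : Type*} [Fintype ρ] {d : ℕ} (cl : ρ → ZMod d) (c : ZMod d) : ℕ :=
  (Finset.univ.filter fun α => cl α = c).card

theorem sum_classSize {ρ : Type*} [Fintype ρ] {d : ℕ} [NeZero d] (cl : ρ → ZMod d) : ∑ c, classSize cl c = Fintype.card ρ :=
  (Finset.card_eq_sum_card_fiberwise fun _ _ => Finset.mem_coe.2 (Finset.mem_univ _)).symm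

theorem classSize_pos {ρ : Type*} [Fintype ρ] {d : ℕ} (cl : ρ → ZMod d) (z : ρ) : 1 ≤ classSize cl (cl z) :=
  Finset.card_pos.2 ⟨z, by simp⟩

/-- The nodes of an injective sequence running through the classes, seen from position `j`. -/
theorem div_succ_le_classSize {ρ : Type*} [Fintype ρ] {d : ℕ} [NeZero d] {cl : ρ → ZMod d}
    {n : ℕ} {v : ℕ → ρ} {c : ZMod d}
    (hv : Set.InjOn v (Set.Iio n)) (hcl : ∀ i < n, cl (v i) = c + i) {j : ℕ} (hj : j < n) :
    j / d + 1 ≤ classSize cl (c + j) := by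
  rw [← Finset.card_range (j / d + 1)]
  -- Stepping back from `j` by multiples of `d` stays in the class and inside the sequence.
  have hle : ∀ a ∈ Finset.range (j / d + 1), d * a ≤ j := fun a ha =>
    (Nat.mul_le_mul_left d (Nat.lt_succ_iff.1 (Finset.mem_range.1 ha))).trans (Nat.mul_div_le j d)
  refine Finset.card_le_card_of_injOn (fun a => v (j - d * a)) ?_ ?_
  · intro a ha
    have := hle a ha
    simp only [Finset.coe_filter, Finset.mem_univ, true_and, Set.mem_ofPred_eq]
    rw [hcl _ (by omega), Nat.cast_sub this]
    simp
  · intro a ha b hb hab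
    have h1 := hle a ha
    have h2 := hle b hb
    have h3 := hv (show j - d * a < n by omega) (show j - d * b < n by omega) hab
    exact Nat.eq_of_mul_eq_mul_left (NeZero.pos d) (by omega)

/-! ### Rows of critical nodes of a matrix with cyclic classes -/

section Core

variable {ρ : Type*} [Fintype ρ] [DecidableEq ρ] {B : Matrix ρ ρ ℝ≥0}

variable {d : ℕ} {cl : ρ → ZMod d}

theorem class_of_maxPow_ne_zero (hcl : ∀ α β, B α β ≠ 0 → cl β = cl α + 1) {t : ℕ} {α β : ρ}
    (h : maxPow B t α β ≠ 0) : cl β = cl α + t := by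
  obtain ⟨w, rfl, rfl, hw⟩ := exists_walkWeight_eq h
  rw [← hw, walkWeight_ne_zero_iff] at h
  clear hw
  induction t with
  | zero => simp
  | succ t ih =>
    rw [hcl _ _ (h t (by omega)), ih fun i hi => h i (by omega)]
    push_cast; ring

theorem dvd_of_maxPow_self_ne_zero (hcl : ∀ α β, B α β ≠ 0 → cl β = cl α + 1) {t : ℕ} {α : ρ}
    (h : maxPow B t α α ≠ 0) : d ∣ t := by
  have := class_of_maxPow_ne_zero hcl h
  rwa [left_eq_add, ZMod.natCast_eq_zero_iff] at this

theorem mem_class_of_maxPow_mul (hcl : ∀ α β, B α β ≠ 0 → cl β = cl α + 1) {e : ℕ} (he : d ∣ e)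
    {z β : ρ} {t : ℕ} (h : maxPow B (e * t) z β ≠ 0) :
    β ∈ Finset.univ.filter fun α => cl α = cl z := by
  have h1 := class_of_maxPow_ne_zero hcl h
  rw [(ZMod.natCast_eq_zero_iff _ _).2 (he.mul_right t), add_zero] at h1
  simpa using h1

theorem rowPeriodicFrom_class_loop (hB : ClosedLeOne B)
    (hcl : ∀ α β, B α β ≠ 0 → cl β = cl α + 1) {g : ℕ} (hg : 0 < g) {z : ρ}
    (hz : maxPow B g z z = 1) : RowPeriodicFrom B z ((classSize cl (cl z) - 1) * g) :=
  rowPeriodicFrom_of_loop hB hg hz fun _ _ h => mem_class_of_maxPow_mul hcl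
    (dvd_of_maxPow_self_ne_zero hcl (hz.trans_ne one_ne_zero)) h

/-- The power `maxPow B d` preserves each class, so the Wielandt bound for it involves only the
class of `z`; each of its steps counts `d` times. -/
theorem rowPeriodicFrom_class_wielandt [NeZero d] (hB : ClosedLeOne B)
    (hcl : ∀ α β, B α β ≠ 0 → cl β = cl α + 1) {p : ℕ} (hp : 0 < p) {z : ρ}
    (hz : maxPow B p z z = 1) : RowPeriodicFrom B z (d * wielandt (classSize cl (cl z))) := by
  have hz' : maxPow (maxPow B d) p z z = 1 := by
    rw [← maxPow_mul, ← critWalk_self_iff hB]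
    exact ((critWalk_self_iff hB).2 hz).mul hB d
  obtain ⟨u, hu, h⟩ := rowPeriodicFrom_wielandt (hB.maxPow d) hp hz'
    (S := Finset.univ.filter fun α => cl α = cl z) fun t j h =>
      mem_class_of_maxPow_mul hcl dvd_rfl (by rwa [maxPow_mul])
  refine ⟨d * u, Nat.mul_pos (NeZero.pos d) hu, fun j => ?_⟩
  rw [← mul_add, maxPow_mul, maxPow_mul]
  exact h j

theorem CritWalk.self_pos (hB : ClosedLeOne B) {p : ℕ} (hp : 0 < p) {α β : ρ} {s : ℕ}
    (hα : maxPow B p α α = 1) (h : CritWalk B s α β) : ∃ q, 0 < q ∧ maxPow B q β β = 1 := by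
  obtain ⟨s', h'⟩ := h.symm
  exact ⟨s' + p + s, by omega, (critWalk_self_iff hB).1
    ((h'.trans hB ((critWalk_self_iff hB).2 hα)).trans hB h)⟩

/-- A critical walk from `α` visits every class, so none is empty. This makes the truncated
difference `Fintype.card ρ / d - 1` a genuine one. -/
theorem one_le_card_div [NeZero d] (hB : ClosedLeOne B)
    (hcl : ∀ α β, B α β ≠ 0 → cl β = cl α + 1) {p : ℕ} (hp : 0 < p) {α : ρ}
    (hα : maxPow B p α α = 1) : 1 ≤ Fintype.card ρ / d := by
  have hsel := exists_small_class (classSize cl) (cl α)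
  rw [sum_classSize] at hsel
  rcases hsel with ⟨s, -, hsm⟩ | ⟨-, s, -, hsm, -⟩
  · omega
  · obtain ⟨z, hz⟩ := ((critWalk_self_iff hB).2 hα).exists_length hB hp s
    rw [← hsm, ← class_of_maxPow_ne_zero hcl hz.ne_zero]
    exact classSize_pos cl z

/-- Follow a critical walk to a small class. Either its size is exactly the integer part and at most
`Fintype.card ρ % d` steps are needed, or it is smaller and fewer than `d` steps are needed, which
the smaller Wielandt number absorbs. -/
theorem rowPeriodicFrom_wielandt_bound [NeZero d] (hB : ClosedLeOne B)
    (hcl : ∀ α β, B α β ≠ 0 → cl β = cl α + 1) {p : ℕ} (hp : 0 < p) {α : ρ}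
    (hα : maxPow B p α α = 1) :
    RowPeriodicFrom B α (d * wielandt (Fintype.card ρ / d) + Fintype.card ρ % d) := by
  have key : ∀ s : ℕ, ∃ z, CritWalk B s α z ∧ cl z = cl α + s ∧
      RowPeriodicFrom B α (s + d * wielandt (classSize cl (cl z))) := by
    intro s
    obtain ⟨z, hz⟩ := ((critWalk_self_iff hB).2 hα).exists_length hB hp s
    obtain ⟨q, hq, hq'⟩ := hz.self_pos hB hp hα
    exact ⟨z, hz, class_of_maxPow_ne_zero hcl hz.ne_zero,
      .of_critWalk hB hz (rowPeriodicFrom_class_wielandt hB hcl hq hq')⟩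
  have hsel := exists_small_class (classSize cl) (cl α)
  rw [sum_classSize] at hsel
  rcases hsel with ⟨s, hs, hsm⟩ | ⟨-, s, hs, hsm, -⟩
  · obtain ⟨z, -, hzc, h⟩ := key s
    refine h.mono ?_
    rw [← hzc] at hsm
    have h1 := Nat.mul_le_mul_left d (Nat.succ_le_of_lt
      (wielandt_lt_wielandt (classSize_pos cl z) hsm))
    rw [Nat.mul_succ] at h1
    omega
  · obtain ⟨z, -, hzc, h⟩ := key s
    refine h.mono ?_
    rw [hzc, hsm]
    omega

/-- The small class is reached along the closed walk of length `g` itself, so the node reached still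
has a closed critical walk of that length. A class below the average saves `g ≥ d` steps. -/
theorem rowPeriodicFrom_loop_bound [NeZero d] (hB : ClosedLeOne B)
    (hcl : ∀ α β, B α β ≠ 0 → cl β = cl α + 1) {g : ℕ} (hg : 0 < g) {α : ρ}
    (hα : maxPow B g α α = 1) :
    RowPeriodicFrom B α ((Fintype.card ρ / d - 1) * g + Fintype.card ρ % d) := by
  have hdg : d ≤ g := Nat.le_of_dvd hg
    (dvd_of_maxPow_self_ne_zero hcl (hα.trans_ne one_ne_zero))
  have key : ∀ s ≤ g, ∃ z, cl z = cl α + s ∧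
      RowPeriodicFrom B α (s + (classSize cl (cl z) - 1) * g) := by
    intro s hs
    obtain ⟨e, rfl⟩ := Nat.exists_eq_add_of_le hs
    obtain ⟨z, hz, hz'⟩ := ((critWalk_self_iff hB).2 hα).split hB
    refine ⟨z, class_of_maxPow_ne_zero hcl hz.ne_zero,
      .of_critWalk hB hz (rowPeriodicFrom_class_loop hB hcl hg ?_)⟩
    rw [← critWalk_self_iff hB, add_comm]
    exact hz'.trans hB hz
  have hsel := exists_small_class (classSize cl) (cl α)
  rw [sum_classSize] at hsel
  rcases hsel with ⟨s, hs, hsm⟩ | ⟨-, s, hs, hsm, -⟩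
  · obtain ⟨z, hzc, h⟩ := key s (by omega)
    refine h.mono ?_
    rw [← hzc] at hsm
    have h1 := classSize_pos cl z
    have h2 : (classSize cl (cl z) - 1 + 1) * g ≤ (Fintype.card ρ / d - 1) * g :=
      Nat.mul_le_mul_right g (by omega)
    rw [Nat.succ_mul] at h2
    omega
  · have := Nat.mod_lt (Fintype.card ρ) (NeZero.pos d)
    obtain ⟨z, hzc, h⟩ := key s (by omega)
    refine h.mono ?_
    rw [hzc, hsm]
    omega

/-- Go `s₁` steps to a shortest critical cycle and `s₂` more along it to a small class. As `s₁ + g`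
is at most the number of critical nodes reached, the bound containing that number is immediate; the
bound by `Fintype.card ρ` requires counting nodes class by class. Adding `2 * g` on the left avoids
a possibly negative coefficient. -/
theorem rowPeriodicFrom_girth_bound [NeZero d] (hB : ClosedLeOne B)
    (hcl : ∀ α β, B α β ≠ 0 → cl β = cl α + 1) {g : ℕ} {α : ρ}
    (hg : IsLeast (critLengths B α) g) :
    ∃ X, RowPeriodicFrom B α X ∧ X + 2 * g ≤ Fintype.card ρ / d * g +
      min (Fintype.card ρ) ((critNodes B α).ncard + Fintype.card ρ % d) := by
  obtain ⟨s₁, v, hinj, hv, hvg⟩ := exists_lollipop hB hg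
  have hg0 := hg.1.1
  have hcv : ∀ i < s₁ + g, cl (v i) = cl α + i := fun i hi =>
    class_of_maxPow_ne_zero hcl (hv i hi).ne_zero
  have hK := ncard_critNodes_ge hinj hv
  have hKr : (critNodes B α).ncard ≤ Fintype.card ρ := by
    rw [← Nat.card_eq_fintype_card]; exact Set.ncard_le_card _
  have hdvd : d ∣ g := dvd_of_maxPow_self_ne_zero hcl
    ((hvg s₁ le_rfl (by omega)).trans_ne one_ne_zero)
  have hdg : d ≤ g := Nat.le_of_dvd hg0 hdvd
  have hgc : (g : ZMod d) = 0 := (ZMod.natCast_eq_zero_iff _ _).2 hdvd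
  have key : ∀ s₂ < g, RowPeriodicFrom B α
      (s₁ + s₂ + (classSize cl (cl α + s₁ + s₂) - 1) * g) := by
    intro s₂ hs₂
    refine .of_critWalk hB (hv (s₁ + s₂) (by omega)) ?_
    have := rowPeriodicFrom_class_loop hB hcl hg0 (hvg (s₁ + s₂) (by omega) (by omega))
    rwa [hcv _ (by omega), Nat.cast_add, ← add_assoc] at this
  have hpos : ∀ s₂ < g, 1 ≤ classSize cl (cl α + s₁ + s₂) := by
    intro s₂ hs₂
    have := classSize_pos cl (v (s₁ + s₂))
    rwa [hcv _ (by omega), Nat.cast_add, ← add_assoc] at this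
  have hsel := exists_small_class (classSize cl) (cl α + s₁)
  have hbig := @card_le_mod_of_div_lt d _ (classSize cl)
  rw [sum_classSize] at hsel hbig
  set r := Fintype.card ρ with hr
  have hrd := Nat.div_add_mod r d
  have hmod := Nat.mod_lt r (NeZero.pos d)
  rcases hsel with ⟨s₂, hs₂, hsm⟩ | ⟨hall, s₂, hs₂, hsm, hsmin⟩
  · refine ⟨_, key s₂ (by omega), ?_⟩
    have h1 := hpos s₂ (by omega)
    have h2 : (classSize cl (cl α + s₁ + s₂) - 1 + 2) * g ≤ r / d * g :=
      Nat.mul_le_mul_right g (by omega)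
    rw [Nat.add_mul] at h2
    omega
  · refine ⟨_, key s₂ (by omega), ?_⟩
    have h1 := hpos s₂ (by omega)
    rw [hsm] at h1 ⊢
    have h2 : (r / d - 1 + 1) * g = r / d * g := by rw [Nat.sub_add_cancel h1]
    rw [Nat.succ_mul] at h2
    suffices hP : s₁ + s₂ + g ≤ r by omega
    -- the position `P` has the class of the end point of the walk
    set P := s₁ + s₂ + g with hP
    have hPc : ∀ y ≤ P, cl α + ((P - y : ℕ) : ZMod d) = cl α + s₁ + s₂ - y := by
      intro y hy
      rw [Nat.cast_sub hy, hP]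
      push_cast
      rw [hgc]; ring
    -- Since `s₂ < d`, position `P - d` lies in the injective sequence; it has the class of the end
    -- point, which contains only `r / d` nodes.
    have hPd : P / d ≤ r / d := by
      have h3 := div_succ_le_classSize hinj hcv (j := P - d) (by omega)
      rw [hPc d (by omega), ZMod.natCast_self, sub_zero, hsm] at h3
      have h4 : P / d = (P - d) / d + 1 := by
        rw [← Nat.add_div_right _ (NeZero.pos d), Nat.sub_add_cancel (by omega)]
      omega
    have hPm := Nat.div_add_mod P d
    rcases hPd.lt_or_eq with hlt | heq
    · have h5 : d * (P / d + 1) ≤ d * (r / d) := Nat.mul_le_mul_left d hlt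
      have h6 := Nat.mod_lt P (NeZero.pos d)
      rw [Nat.mul_succ] at h5
      omega
    -- If the quotients agree, the `P % d` classes preceding that of the end point all have more
    -- than `r / d` nodes: by minimality of `s₂` if they are met after step `s₁`, and otherwise
    -- because the sequence itself puts enough nodes into them. At most `r % d` classes are that
    -- large.
    · suffices hb : P % d ≤ r % d by rw [heq] at hPm; omega
      have hPlt := Nat.mod_lt P (NeZero.pos d)
      have h7 := hbig hall (F := (Finset.range (P % d)).image
        fun y : ℕ => (cl α + s₁ + s₂ - 1) - (y : ZMod d)) ?_
      · rwa [Finset.card_image_of_injOn (injOn_sub_natCast _ hPlt.le), Finset.card_range] at h7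
      · intro c hc
        obtain ⟨y, hy, rfl⟩ := Finset.mem_image.1 hc
        rw [Finset.mem_range] at hy
        have hyc : (cl α + s₁ + s₂ - 1) - (y : ZMod d) = cl α + s₁ + s₂ - ((y + 1 : ℕ) : ZMod d) := by
          push_cast; ring
        rw [hyc]
        by_cases hys : y + 1 ≤ s₂
        · have := hsmin (s₂ - (y + 1)) (by omega)
          rw [Nat.cast_sub hys] at this
          rwa [add_sub_assoc]
        · have h8 := div_succ_le_classSize hinj hcv (j := P - (y + 1)) (by omega)
          rw [hPc _ (by omega)] at h8
          have h9 : P / d ≤ (P - (y + 1)) / d := by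
            rw [Nat.le_div_iff_mul_le (NeZero.pos d), mul_comm]
            omega
          omega

end Core

/-! ### The bipartite matrix of a factorization -/

/-- The matrix with off-diagonal blocks `V` and `U`. -/
abbrev offDiag {ι ρ : Type*} (V : Matrix ι ρ ℝ≥0) (U : Matrix ρ ι ℝ≥0) : Matrix (ι ⊕ ρ) (ι ⊕ ρ) ℝ≥0 :=
  Matrix.fromBlocks 0 V U 0

theorem maxMul_offDiag_self {ι ρ : Type*} [Fintype ι] [Fintype ρ]
    (V : Matrix ι ρ ℝ≥0) (U : Matrix ρ ι ℝ≥0) :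
    maxMul (offDiag V U) (offDiag V U) = Matrix.fromBlocks (maxMul V U) 0 0 (maxMul U V) := by
  ext x y : 1
  rcases x with x | x <;> rcases y with y | y <;> apply le_antisymm
  all_goals first
    | (refine maxMul_le fun z => ?_
       rcases z with z | z <;> simp [le_maxMul])
    | skip
  · exact maxMul_le fun z => le_maxMul (offDiag V U) (offDiag V U) (.inl x) (.inr z) (.inl y)
  · exact zero_le
  · exact zero_le
  · exact maxMul_le fun z => le_maxMul (offDiag V U) (offDiag V U) (.inr x) (.inl z) (.inr y)

theorem maxMul_fromBlocks_diag {ι ρ : Type*} [Fintype ι] [Fintype ρ]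
    (A A' : Matrix ι ι ℝ≥0) (B B' : Matrix ρ ρ ℝ≥0) :
    maxMul (Matrix.fromBlocks A 0 0 B) (Matrix.fromBlocks A' 0 0 B') =
      Matrix.fromBlocks (maxMul A A') 0 0 (maxMul B B') := by
  ext x y : 1
  rcases x with x | x <;> rcases y with y | y <;> apply le_antisymm
  all_goals first
    | (refine maxMul_le fun z => ?_
       rcases z with z | z <;> simp [le_maxMul])
    | skip
  · exact maxMul_le fun z => le_maxMul (Matrix.fromBlocks A 0 0 B) (Matrix.fromBlocks A' 0 0 B')
      (.inl x) (.inl z) (.inl y)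
  · exact zero_le
  · exact zero_le
  · exact maxMul_le fun z => le_maxMul (Matrix.fromBlocks A 0 0 B) (Matrix.fromBlocks A' 0 0 B')
      (.inr x) (.inr z) (.inr y)

section Bipartite

variable {ι ρ : Type*} [Fintype ι] [DecidableEq ι] [Fintype ρ] [DecidableEq ρ]
  {V : Matrix ι ρ ℝ≥0} {U : Matrix ρ ι ℝ≥0}

theorem maxPow_offDiag_two_mul (V : Matrix ι ρ ℝ≥0) (U : Matrix ρ ι ℝ≥0) (t : ℕ) :
    maxPow (offDiag V U) (2 * t) =
      Matrix.fromBlocks (maxPow (maxMul V U) t) 0 0 (maxPow (maxMul U V) t) := by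
  rw [maxPow_mul, show maxPow (offDiag V U) 2 = _ from
    (congrArg (maxMul · (offDiag V U)) (maxPow_one _)).trans (maxMul_offDiag_self V U)]
  induction t with
  | zero => simp [maxPow_zero]
  | succ t ih => rw [maxPow_succ, ih, maxMul_fromBlocks_diag]; rfl

theorem maxPow_offDiag_odd_inl (t : ℕ) (i j : ι) :
    maxPow (offDiag V U) (2 * t + 1) (.inl i) (.inl j) = 0 := by
  rw [maxPow_succ, maxPow_offDiag_two_mul]
  refine le_antisymm (maxMul_le fun z => ?_) zero_le
  rcases z with z | z <;> simp

theorem maxPow_offDiag_odd_inr (t : ℕ) (α β : ρ) :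
    maxPow (offDiag V U) (2 * t + 1) (.inr α) (.inr β) = 0 := by
  rw [maxPow_succ, maxPow_offDiag_two_mul]
  refine le_antisymm (maxMul_le fun z => ?_) zero_le
  rcases z with z | z <;> simp

theorem maxPow_offDiag_inl (t : ℕ) (i j : ι) :
    maxPow (offDiag V U) (2 * t) (.inl i) (.inl j) = maxPow (maxMul V U) t i j := by
  rw [maxPow_offDiag_two_mul]; rfl

theorem maxPow_offDiag_inr (t : ℕ) (α β : ρ) :
    maxPow (offDiag V U) (2 * t) (.inr α) (.inr β) = maxPow (maxMul U V) t α β := by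
  rw [maxPow_offDiag_two_mul]; rfl

theorem closedLeOne_offDiag (hA : ClosedLeOne (maxMul V U)) : ClosedLeOne (offDiag V U) := by
  intro t x
  have hinl : ∀ t i, maxPow (offDiag V U) t (.inl i) (.inl i) ≤ 1 := by
    intro t i
    rcases Nat.even_or_odd' t with ⟨u, rfl | rfl⟩
    · rw [maxPow_offDiag_inl]; exact hA u i
    · rw [maxPow_offDiag_odd_inl]; exact zero_le
  rcases x with i | α
  · exact hinl t i
  · rcases t with - | t
    · simp [maxPow_zero]
    · rw [maxPow_succ]
      refine maxMul_le fun z => ?_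
      rcases z with j | β
      · rw [mul_comm]
        have := le_maxPow_add (offDiag V U) 1 t (.inl j) (.inr α) (.inl j)
        rw [maxPow_one] at this
        exact this.trans (hinl _ j)
      · simp

theorem critWalk_offDiag_inl {u : ℕ} {i j : ι} :
    CritWalk (offDiag V U) u (.inl i) (.inl j) ↔ ∃ s, u = 2 * s ∧ CritWalk (maxMul V U) s i j := by
  constructor
  · intro h
    rcases Nat.even_or_odd' u with ⟨s, rfl | rfl⟩
    · refine ⟨s, rfl, ?_⟩
      obtain ⟨s', hs⟩ := h
      rcases Nat.even_or_odd' s' with ⟨t, rfl | rfl⟩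
      · exact ⟨t, by rwa [maxPow_offDiag_inl, maxPow_offDiag_inl] at hs⟩
      · simp [maxPow_offDiag_odd_inl] at hs
    · exact absurd (maxPow_offDiag_odd_inl s i j) h.ne_zero
  · rintro ⟨s, rfl, t, hs⟩
    exact ⟨2 * t, by rwa [maxPow_offDiag_inl, maxPow_offDiag_inl]⟩

theorem critWalk_offDiag_inr {u : ℕ} {α β : ρ} :
    CritWalk (offDiag V U) u (.inr α) (.inr β) ↔ ∃ s, u = 2 * s ∧ CritWalk (maxMul U V) s α β := by
  constructor
  · intro h
    rcases Nat.even_or_odd' u with ⟨s, rfl | rfl⟩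
    · refine ⟨s, rfl, ?_⟩
      obtain ⟨s', hs⟩ := h
      rcases Nat.even_or_odd' s' with ⟨t, rfl | rfl⟩
      · exact ⟨t, by rwa [maxPow_offDiag_inr, maxPow_offDiag_inr] at hs⟩
      · simp [maxPow_offDiag_odd_inr] at hs
    · exact absurd (maxPow_offDiag_odd_inr s α β) h.ne_zero
  · rintro ⟨s, rfl, t, hs⟩
    exact ⟨2 * t, by rwa [maxPow_offDiag_inr, maxPow_offDiag_inr]⟩

theorem critWalk_offDiag_inl_two_mul {s : ℕ} {i j : ι} :
    CritWalk (offDiag V U) (2 * s) (.inl i) (.inl j) ↔ CritWalk (maxMul V U) s i j := by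
  simp [critWalk_offDiag_inl]

theorem critWalk_offDiag_inr_two_mul {s : ℕ} {α β : ρ} :
    CritWalk (offDiag V U) (2 * s) (.inr α) (.inr β) ↔ CritWalk (maxMul U V) s α β := by
  simp [critWalk_offDiag_inr]

theorem closedLeOne_maxMul_comm (hA : ClosedLeOne (maxMul V U)) : ClosedLeOne (maxMul U V) := by
  intro t α
  rw [← maxPow_offDiag_inr]
  exact closedLeOne_offDiag hA _ _

theorem exists_inr_of_closed (hA : ClosedLeOne (maxMul V U)) {p : ℕ} (hp : 0 < p) {i : ι}
    (hi : maxPow (maxMul V U) p i i = 1) :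
    ∃ α, CritWalk (offDiag V U) 1 (.inl i) (.inr α) ∧ maxPow (maxMul U V) p α α = 1 := by
  have hZ := closedLeOne_offDiag hA
  have h := critWalk_offDiag_inl_two_mul.2 ((critWalk_self_iff hA).2 hi)
  rw [show 2 * p = 1 + (2 * p - 1) by omega] at h
  obtain ⟨x, hx, hx'⟩ := h.split hZ
  rcases x with j | α
  · exact absurd (maxPow_offDiag_odd_inl 0 i j) hx.ne_zero
  · have h2 := hx'.trans hZ hx
    rw [show 2 * p - 1 + 1 = 2 * p by omega, critWalk_offDiag_inr_two_mul,
      critWalk_self_iff (closedLeOne_maxMul_comm hA)] at h2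
    exact ⟨α, hx, h2⟩

theorem exists_inl_of_closed (hA : ClosedLeOne (maxMul V U)) {p : ℕ} (hp : 0 < p) {α : ρ}
    (hα : maxPow (maxMul U V) p α α = 1) :
    ∃ i, CritWalk (offDiag V U) 1 (.inr α) (.inl i) ∧ maxPow (maxMul V U) p i i = 1 := by
  have hZ := closedLeOne_offDiag hA
  have h := critWalk_offDiag_inr_two_mul.2
    ((critWalk_self_iff (closedLeOne_maxMul_comm hA)).2 hα)
  rw [show 2 * p = 1 + (2 * p - 1) by omega] at h
  obtain ⟨x, hx, hx'⟩ := h.split hZ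
  rcases x with i | β
  · have h2 := hx'.trans hZ hx
    rw [show 2 * p - 1 + 1 = 2 * p by omega, critWalk_offDiag_inl_two_mul,
      critWalk_self_iff hA] at h2
    exact ⟨i, hx, h2⟩
  · exact absurd (maxPow_offDiag_odd_inr 0 α β) hx.ne_zero

/-- In the bipartite matrix one pays `2 * s + 1` steps to reach `α` and `2 * X` more; rounding up to
an even time and halving gives `s + X + 1`. -/
theorem RowPeriodicFrom.of_critWalk_offDiag (hA : ClosedLeOne (maxMul V U)) {s X : ℕ} {k : ι}
    {α : ρ} (h : CritWalk (offDiag V U) (2 * s + 1) (.inl k) (.inr α))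
    (hα : RowPeriodicFrom (maxMul U V) α X) : RowPeriodicFrom (maxMul V U) k (s + X + 1) := by
  have hZα : RowPeriodicFrom (offDiag V U) (.inr α) (2 * X) := by
    obtain ⟨p, hp, hper⟩ := hα
    refine ⟨2 * p, by omega, fun x => ?_⟩
    rw [← mul_add]
    rcases x with i | β
    · rw [maxPow_offDiag_two_mul, maxPow_offDiag_two_mul]; rfl
    · rw [maxPow_offDiag_inr, maxPow_offDiag_inr, hper]
  obtain ⟨p, hp, hper⟩ := (RowPeriodicFrom.of_critWalk (closedLeOne_offDiag hA) h hZα).mono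
    (show 2 * s + 1 + 2 * X ≤ 2 * (s + X + 1) by omega)
  refine ⟨p, hp, fun j => ?_⟩
  rw [← maxPow_offDiag_inl, ← maxPow_offDiag_inl, mul_add]
  exact maxPow_add_mul_period hper 2 le_rfl (.inl j)

/-- Each critical closed walk of one product interleaves with one of the other of the same length,
as the two kinds of nodes alternate in the bipartite matrix. -/
theorem isLeast_critLengths_maxMul_comm (hA : ClosedLeOne (maxMul V U)) {k : ι} {g : ℕ}
    (hg : IsLeast (critLengths (maxMul V U) k) g) {α : ρ} {u : ℕ}
    (hα : CritWalk (offDiag V U) u (.inl k) (.inr α)) :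
    IsLeast (critLengths (maxMul U V) α) g := by
  have hZ := closedLeOne_offDiag hA
  constructor
  · obtain ⟨hg0, b, ⟨s, hs⟩, hb⟩ := hg.1
    obtain ⟨β, hβ, hβ'⟩ := exists_inr_of_closed hA hg0 hb
    obtain ⟨u', hu'⟩ := hα.symm
    obtain ⟨s', -, hs'⟩ := critWalk_offDiag_inr.1
      ((hu'.trans hZ (critWalk_offDiag_inl_two_mul.2 hs)).trans hZ hβ)
    exact ⟨hg0, β, ⟨s', hs'⟩, hβ'⟩
  · rintro ℓ ⟨hℓ, β, ⟨s, hs⟩, hβ⟩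
    obtain ⟨i, hi, hi'⟩ := exists_inl_of_closed hA hℓ hβ
    obtain ⟨s', -, hs'⟩ := critWalk_offDiag_inl.1
      ((hα.trans hZ (critWalk_offDiag_inr_two_mul.2 hs)).trans hZ hi)
    exact hg.2 ⟨hℓ, i, ⟨s', hs'⟩, hi'⟩

/-- Bounds for the row of a critical node of a factorized matrix whose closed walks have weight
at most one, in terms of compatible partitions of both kinds of nodes into `d` cyclic classes. -/
theorem rowPeriodicFrom_factorization (hA : ClosedLeOne (maxMul V U)) {d : ℕ} [NeZero d]
    {clA : ι → ZMod d} {clB : ρ → ZMod d} (hV : ∀ i α, V i α ≠ 0 → clB α = clA i)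
    (hU : ∀ α i, U α i ≠ 0 → clA i = clB α + 1) {k : ι} {p : ℕ} (hp : 0 < p)
    (hk : maxPow (maxMul V U) p k k = 1) {g : ℕ}
    (hg : IsLeast (critLengths (maxMul V U) k) g) :
    RowPeriodicFrom (maxMul V U) k
        (d * wielandt (Fintype.card ρ / d) + Fintype.card ρ % d + 1) ∧
      ∃ X, RowPeriodicFrom (maxMul V U) k (X + 1) ∧ X + 2 * g ≤ Fintype.card ρ / d * g +
        min (Fintype.card ρ) (min (critNodes (maxMul V U) k).ncard
          {β | Sum.inr β ∈ critNodes (offDiag V U) (.inl k)}.ncard + Fintype.card ρ % d) := by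
  have hZ := closedLeOne_offDiag hA
  have hB := closedLeOne_maxMul_comm hA
  have hcl : ∀ α β, maxMul U V α β ≠ 0 → clB β = clB α + 1 := by
    intro α β h
    obtain ⟨i, hi⟩ := exists_maxMul_eq h
    rw [← hi] at h
    rw [hV i β (right_ne_zero_of_mul h), hU α i (left_ne_zero_of_mul h)]
  obtain ⟨α, hα, hα'⟩ := exists_inr_of_closed hA hp hk
  have hq := one_le_card_div hB hcl hp hα'
  have hlink : ∀ X, RowPeriodicFrom (maxMul U V) α X → RowPeriodicFrom (maxMul V U) k (X + 1) := by
    intro X hX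
    simpa using RowPeriodicFrom.of_critWalk_offDiag hA (s := 0) hα hX
  refine ⟨hlink _ (rowPeriodicFrom_wielandt_bound hB hcl hp hα'), ?_⟩
  have hsub : critNodes (maxMul U V) α ⊆ {β | Sum.inr β ∈ critNodes (offDiag V U) (.inl k)} := by
    rintro β ⟨s, hs⟩
    exact ⟨_, hα.trans hZ (critWalk_offDiag_inr_two_mul.2 hs)⟩
  have hcard := Set.ncard_le_ncard hsub (Set.toFinite _)
  obtain ⟨X, hX, hXle⟩ := rowPeriodicFrom_girth_bound hB hcl
    (isLeast_critLengths_maxMul_comm hA hg hα)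
  set cA := (critNodes (maxMul V U) k).ncard
  set cB := {β | Sum.inr β ∈ critNodes (offDiag V U) (.inl k)}.ncard
  -- If `cA` does not improve the bound, the approach to a shortest cycle is made in `maxMul U V`.
  -- Otherwise it is made in `maxMul V U`, where it costs at most `cA - g`, and only then does the
  -- walk cross to the other kind of nodes.
  by_cases hcase : cB ≤ cA ∨ Fintype.card ρ ≤ cA + Fintype.card ρ % d
  · exact ⟨X, hlink X hX, by omega⟩
  · obtain ⟨s, v, hinj, hv, hvg⟩ := exists_lollipop hA hg
    have hg0 := hg.1.1
    have hsA : s + g ≤ cA := ncard_critNodes_ge hinj hv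
    obtain ⟨β, hβ, hβ'⟩ := exists_inr_of_closed hA hg0 (hvg s le_rfl (by omega))
    have h1 := (critWalk_offDiag_inl_two_mul.2 (hv s (by omega))).trans hZ hβ
    refine ⟨_, RowPeriodicFrom.of_critWalk_offDiag hA h1
      (rowPeriodicFrom_loop_bound hB hcl hg0 hβ'), ?_⟩
    have h2 : (Fintype.card ρ / d - 1 + 1) * g = Fintype.card ρ / d * g := by rw [Nat.sub_add_cancel hq]
    rw [Nat.succ_mul] at h2
    omega

end Bipartite

/-! ### Critical graphs of normalized matrices -/

theorem digraph_smul {ι : Type*} {c : ℝ≥0} (hc : c ≠ 0) (M : Matrix ι ι ℝ≥0) :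
    digraph (c • M) = digraph M := by
  simp [digraph, hc]

theorem geomMean_pow {ι : Type*} (M : Matrix ι ι ℝ≥0) {ℓ : ℕ} (hℓ : 0 < ℓ) (w : ℕ → ι) :
    geomMean M ℓ w ^ ℓ = walkWeight M ℓ w := by
  rw [geomMean, one_div, NNReal.rpow_inv_natCast_pow _ hℓ.ne']

theorem walkWeight_inv_smul {ι : Type*} (M : Matrix ι ι ℝ≥0) {c : ℝ≥0} {ℓ : ℕ} (hℓ : 0 < ℓ)
    (w : ℕ → ι) : walkWeight (c⁻¹ • M) ℓ w = (geomMean M ℓ w / c) ^ ℓ := by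
  rw [walkWeight_smul, ← geomMean_pow M hℓ w, ← mul_pow, div_eq_inv_mul]

theorem bddAbove_geomMean {ι : Type*} [Finite ι] (M : Matrix ι ι ℝ≥0) :
    BddAbove {x | ∃ ℓ w, IsCycle (digraph M) ℓ w ∧ x = geomMean M ℓ w} := by
  obtain ⟨C, hC⟩ := (Set.finite_range fun p : ι × ι => M p.1 p.2).bddAbove
  refine ⟨C, ?_⟩
  rintro _ ⟨ℓ, w, hw, rfl⟩
  rw [← pow_le_pow_iff_left₀ zero_le zero_le hw.1.ne', geomMean_pow M hw.1]
  calc walkWeight M ℓ w ≤ ∏ _i ∈ Finset.range ℓ, C :=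
        Finset.prod_le_prod' fun i _ => hC ⟨(w i, w (i + 1)), rfl⟩
    _ = C ^ ℓ := by simp

theorem exists_repeat_of_not_injOn {ι : Type*} {w : ℕ → ι} {t : ℕ}
    (h : ¬ Set.InjOn w (Set.Iio t)) : ∃ i j, i < j ∧ j < t ∧ w i = w j := by
  simp only [Set.InjOn, not_forall] at h
  obtain ⟨i, hi, j, hj, heq, hne⟩ := h
  rcases lt_or_gt_of_ne hne with h | h
  · exact ⟨i, j, h, hj, heq⟩
  · exact ⟨j, i, h, hi, heq.symm⟩

theorem maxCycleMean_ne_zero {ι : Type*} {M : Matrix ι ι ℝ≥0} {k : ι} (hk : IsCriticalNode M k) : maxCycleMean M ≠ 0 := by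
  obtain ⟨ℓ, w, ⟨hw, hmean⟩, -⟩ := hk
  rw [← hmean]
  intro h0
  refine walkWeight_ne_zero_iff.2 hw.2.1 ?_
  rw [← geomMean_pow M hw.1, h0, zero_pow hw.1.ne']

theorem isCriticalCycle_iff {ι : Type*} {M : Matrix ι ι ℝ≥0} (h0 : maxCycleMean M ≠ 0) {ℓ : ℕ} {w : ℕ → ι} :
    IsCriticalCycle M ℓ w ↔ IsCycle (digraph ((maxCycleMean M)⁻¹ • M)) ℓ w ∧
      walkWeight ((maxCycleMean M)⁻¹ • M) ℓ w = 1 := by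
  rw [digraph_smul (inv_ne_zero h0), IsCriticalCycle, and_congr_right_iff]
  intro hw
  rw [walkWeight_inv_smul M hw.1, pow_eq_one_iff, or_iff_left hw.1.ne', div_eq_one_iff_eq h0]

section Square

variable {ι : Type*} [Fintype ι] [DecidableEq ι] {M : Matrix ι ι ℝ≥0}

/-- A closed walk that is not a cycle splits at a repeated node into two shorter closed walks. -/
theorem closedLeOne_of_cycles (h : ∀ ℓ w, IsCycle (digraph M) ℓ w → walkWeight M ℓ w ≤ 1) :
    ClosedLeOne M := by
  intro t
  induction t using Nat.strong_induction_on with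
  | _ t ih =>
    intro i
    by_cases h0 : maxPow M t i i = 0
    · simp [h0]
    rcases Nat.eq_zero_or_pos t with rfl | ht
    · simp [maxPow_zero]
    obtain ⟨w, rfl, hwt, hw⟩ := exists_walkWeight_eq h0
    by_cases hinj : Set.InjOn w (Set.Iio t)
    · rw [← hw]
      refine h t w ⟨ht, walkWeight_ne_zero_iff.1 (hw ▸ h0), hwt, hinj⟩
    · obtain ⟨a, b, hab, hb, heq⟩ := exists_repeat_of_not_injOn hinj
      obtain ⟨c, hc, hc'⟩ := walkWeight_le_maxPow_sub M hab.le w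
      obtain ⟨e, he, he'⟩ := walkWeight_le_maxPow_sub M hb.le w
      rw [← heq] at hc he
      rw [hwt] at he
      rw [← hw, he', hc']
      calc walkWeight M a w * c * e = (walkWeight M a w * e) * c := by ring
        _ ≤ maxPow M (a + (t - b)) (w 0) (w 0) * maxPow M (b - a) (w a) (w a) :=
          mul_le_mul' ((mul_le_mul' (walkWeight_le_maxPow M a w) he).trans
            (le_maxPow_add M _ _ _ _ _)) hc
        _ ≤ 1 * 1 := mul_le_mul' (ih _ (by omega) _) (ih _ (by omega) _)
        _ = 1 := one_mul 1

theorem dvd_of_closed_walk {d : ℕ} (h : ∀ ℓ w, IsCycle (digraph M) ℓ w → d ∣ ℓ) (t : ℕ) (i : ι)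
    (h0 : maxPow M t i i ≠ 0) : d ∣ t := by
  induction t using Nat.strong_induction_on generalizing i with
  | _ t ih =>
    rcases Nat.eq_zero_or_pos t with rfl | ht
    · exact dvd_zero d
    obtain ⟨w, rfl, hwt, hw⟩ := exists_walkWeight_eq h0
    rw [← hw] at h0
    by_cases hinj : Set.InjOn w (Set.Iio t)
    · exact h t w ⟨ht, walkWeight_ne_zero_iff.1 h0, hwt, hinj⟩
    · obtain ⟨a, b, hab, hb, heq⟩ := exists_repeat_of_not_injOn hinj
      obtain ⟨c, hc, hc'⟩ := walkWeight_le_maxPow_sub M hab.le w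
      obtain ⟨e, he, he'⟩ := walkWeight_le_maxPow_sub M hb.le w
      rw [← heq] at hc he
      rw [hwt] at he
      rw [he', hc', mul_ne_zero_iff, mul_ne_zero_iff] at h0
      have h1 := ih (b - a) (by omega) (w a) fun h => h0.1.2 (le_antisymm (h ▸ hc) zero_le)
      have h2 := ih (a + (t - b)) (by omega) (w 0) fun h => mul_ne_zero h0.1.1 h0.2
        (le_antisymm (h ▸ (mul_le_mul' (walkWeight_le_maxPow M a w) he).trans
          (le_maxPow_add M _ _ _ _ _)) zero_le)
      have h3 := h1.add h2
      rwa [show b - a + (a + (t - b)) = t by omega] at h3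

theorem critWalk_of_walkWeight_eq_one (hM : ClosedLeOne M) {ℓ : ℕ} {w : ℕ → ι}
    (hw : walkWeight M ℓ w = 1) (hwℓ : w ℓ = w 0) {i j : ℕ} (hij : i ≤ j) (hj : j ≤ ℓ) :
    CritWalk M (j - i) (w i) (w j) := by
  obtain ⟨c, hc, hc'⟩ := walkWeight_le_maxPow_sub M hij w
  obtain ⟨e, he, he'⟩ := walkWeight_le_maxPow_sub M hj w
  rw [hwℓ] at he
  refine hM.critWalk (s' := ℓ - j + i) ?_
  calc (1 : ℝ≥0) = c * (e * walkWeight M i w) := by rw [← hw, he', hc']; ring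
    _ ≤ _ := mul_le_mul' hc ((mul_le_mul' he (walkWeight_le_maxPow M i w)).trans
      (le_maxPow_add M _ _ _ _ _))

/-- A critical edge lies on a cycle of weight one. -/
theorem CritWalk.exists_cycle (hM : ClosedLeOne M) {a b : ι} (h : CritWalk M 1 a b) :
    ∃ ℓ w, IsCycle (digraph M) ℓ w ∧ walkWeight M ℓ w = 1 ∧ w 0 = a ∧ w 1 = b := by
  classical
  obtain ⟨s, hs, hmin⟩ : ∃ s, M a b * maxPow M s b a = 1 ∧
      ∀ s' < s, M a b * maxPow M s' b a ≠ 1 := by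
    have hex : ∃ s, M a b * maxPow M s b a = 1 := by simpa [CritWalk, maxPow_one] using h
    exact ⟨Nat.find hex, Nat.find_spec hex, fun s' h => Nat.find_min hex h⟩
  have hmin' : ∀ s' < s, ¬ 1 ≤ M a b * maxPow M s' b a := fun s' hs' h1 => by
    refine hmin s' hs' (le_antisymm ?_ h1)
    have := le_maxPow_add M 1 s' a b a
    rw [maxPow_one] at this
    exact this.trans (hM _ _)
  obtain ⟨x, hx0, hxs, hx⟩ := exists_walkWeight_eq (right_ne_zero_of_mul_eq_one hs)
  set w : ℕ → ι := fun i => if i = 0 then a else x (i - 1) with hw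
  have hwx : ∀ i, w (i + 1) = x i := fun i => by simp [hw]
  have hweight : walkWeight M (s + 1) w = 1 := by
    rw [walkWeight, Finset.prod_range_succ', ← hs, ← hx, walkWeight, mul_comm]
    simp only [hwx]
    simp [hw, hx0]
  have hclosed : w (s + 1) = w 0 := by rw [hwx, hxs]; simp [hw]
  refine ⟨s + 1, w, ⟨by omega, walkWeight_ne_zero_iff.1 (hweight ▸ one_ne_zero), hclosed, ?_⟩,
    hweight, by simp [hw], by rw [hwx 0, hx0]⟩
  -- A repetition would allow a closed part of the return to be cut out, or the return to stop at
  -- `a` earlier, contradicting its minimal length.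
  by_contra hinj
  obtain ⟨i, j, hij, hj, heq⟩ := exists_repeat_of_not_injOn hinj
  obtain ⟨j, rfl⟩ : ∃ j', j = j' + 1 := ⟨j - 1, by omega⟩
  rw [hwx] at heq
  rcases i with - | i
  · obtain ⟨c, hc, hc'⟩ := walkWeight_le_maxPow_sub M (show j ≤ s by omega) x
    have hxj : x j = a := by rw [← heq]; simp [hw]
    refine hmin' j (by omega) ?_
    rw [hxs, hxj] at hc
    have h1 := walkWeight_le_maxPow M j x
    rw [hx0, hxj] at h1
    rw [← hs, ← hx, hc']
    exact mul_le_mul_right ((mul_le_of_le_one_right' (hc.trans (hM _ _))).trans h1) _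
  · rw [hwx] at heq
    obtain ⟨c, hc, hc'⟩ := walkWeight_le_maxPow_sub M (show i ≤ j by omega) x
    obtain ⟨e, he, he'⟩ := walkWeight_le_maxPow_sub M (show j ≤ s by omega) x
    rw [hxs, ← heq] at he
    rw [← heq] at hc
    refine hmin' (i + (s - j)) (by omega) ?_
    have h1 := walkWeight_le_maxPow M i x
    rw [hx0] at h1
    rw [← hs, ← hx, he', hc']
    refine mul_le_mul_right ?_ _
    exact (mul_le_mul' ((mul_le_of_le_one_right' (hc.trans (hM _ _))).trans h1) he).trans
      (le_maxPow_add M _ _ _ _ _)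

theorem maxCycleMean_eq_of_closed {c : ℝ≥0} (hc : c ≠ 0) (hM : ClosedLeOne (c⁻¹ • M)) {p : ℕ}
    (hp : 0 < p) {i : ι} (hi : maxPow (c⁻¹ • M) p i i = 1) : maxCycleMean M = c := by
  refine IsGreatest.csSup_eq ⟨?_, ?_⟩
  · have h1 := (critWalk_self_iff hM).2 hi
    obtain ⟨q, rfl⟩ : ∃ q, p = 1 + q := ⟨p - 1, by omega⟩
    obtain ⟨y, hy, -⟩ := h1.split hM
    obtain ⟨ℓ, w, hw, hw1, -⟩ := hy.exists_cycle hM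
    rw [digraph_smul (inv_ne_zero hc)] at hw
    refine ⟨ℓ, w, hw, ?_⟩
    rw [walkWeight_inv_smul M hw.1, pow_eq_one_iff, or_iff_left hw.1.ne', div_eq_one_iff_eq hc] at hw1
    exact hw1.symm
  · rintro _ ⟨ℓ, w, hw, rfl⟩
    have h1 : walkWeight (c⁻¹ • M) ℓ w ≤ 1 :=
      (walkWeight_le_maxPow _ ℓ w).trans (by rw [hw.2.2.1]; exact hM _ _)
    rw [walkWeight_inv_smul M hw.1, pow_le_one_iff hw.1.ne'] at h1
    exact (div_le_one₀ (pos_iff_ne_zero.2 hc)).1 h1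

theorem closedLeOne_inv_smul (h0 : maxCycleMean M ≠ 0) :
    ClosedLeOne ((maxCycleMean M)⁻¹ • M) := by
  refine closedLeOne_of_cycles fun ℓ w hw => ?_
  rw [digraph_smul (inv_ne_zero h0)] at hw
  rw [walkWeight_inv_smul M hw.1, pow_le_one_iff hw.1.ne', div_le_one₀ (pos_iff_ne_zero.2 h0)]
  exact le_csSup (bddAbove_geomMean M) ⟨ℓ, w, hw, rfl⟩

theorem criticalGraph_adj_iff (h0 : maxCycleMean M ≠ 0) {a b : ι} :
    (criticalGraph M).Adj a b ↔ CritWalk ((maxCycleMean M)⁻¹ • M) 1 a b := by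
  have hN := closedLeOne_inv_smul h0
  constructor
  · rintro ⟨ℓ, w, hw, i, hi, rfl, rfl⟩
    rw [isCriticalCycle_iff h0] at hw
    simpa using critWalk_of_walkWeight_eq_one hN hw.2 hw.1.2.2.1 (Nat.le_succ i) hi
  · intro h
    obtain ⟨ℓ, w, hw, hw1, h0', h1'⟩ := h.exists_cycle hN
    exact ⟨ℓ, w, (isCriticalCycle_iff h0).2 ⟨hw, hw1⟩, 0, hw.1, h0', h1'⟩

theorem exists_closed_of_isCriticalNode {k : ι} (hk : IsCriticalNode M k) :
    ∃ p, 0 < p ∧ maxPow ((maxCycleMean M)⁻¹ • M) p k k = 1 := by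
  have h0 := maxCycleMean_ne_zero hk
  have hN := closedLeOne_inv_smul h0
  obtain ⟨ℓ, w, hw, i, hi, rfl⟩ := hk
  rw [isCriticalCycle_iff h0] at hw
  have h1 := critWalk_of_walkWeight_eq_one hN hw.2 hw.1.2.2.1 hi.le le_rfl
  have h2 := critWalk_of_walkWeight_eq_one hN hw.2 hw.1.2.2.1 (Nat.zero_le i) hi.le
  rw [hw.1.2.2.1] at h1
  exact ⟨_, by omega, (critWalk_self_iff hN).1 (h1.trans hN h2)⟩

theorem critWalk_of_isWalk (h0 : maxCycleMean M ≠ 0) {ℓ : ℕ} {w : ℕ → ι}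
    (hw : IsWalk (criticalGraph M) ℓ w) : CritWalk ((maxCycleMean M)⁻¹ • M) ℓ (w 0) (w ℓ) := by
  induction ℓ with
  | zero => exact CritWalk.refl _ _
  | succ ℓ ih =>
    exact (ih fun i hi => hw i (by omega)).trans (closedLeOne_inv_smul h0)
      ((criticalGraph_adj_iff h0).1 (hw ℓ (by omega)))

theorem reaches_criticalGraph_iff (h0 : maxCycleMean M ≠ 0) {a b : ι} :
    Reaches (criticalGraph M) a b ↔ ∃ s, CritWalk ((maxCycleMean M)⁻¹ • M) s a b := by
  have hN := closedLeOne_inv_smul h0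
  constructor
  · rintro ⟨ℓ, w, hw, rfl, rfl⟩
    exact ⟨ℓ, critWalk_of_isWalk h0 hw⟩
  · rintro ⟨s, hs⟩
    obtain ⟨w, hw0, hws, hw⟩ := hs.exists_walk hN
    refine ⟨s, w, fun i hi => (criticalGraph_adj_iff h0).2 ?_, hw0, hws⟩
    simpa using hw i (i + 1) (Nat.le_succ i) hi

/-- Only reachability from `k` needs checking: every critical walk has a critical return. -/
theorem componentNodes_criticalGraph (h0 : maxCycleMean M ≠ 0) (k : ι) :
    componentNodes (criticalGraph M) k = critNodes ((maxCycleMean M)⁻¹ • M) k := by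
  ext j
  simp only [componentNodes, Set.mem_ofPred_eq, reaches_criticalGraph_iff h0, critNodes]
  exact ⟨fun h => h.1, fun h => ⟨h, h.choose_spec.symm⟩⟩

theorem isLeast_girth_component {k : ι} (hk : IsCriticalNode M k) :
    IsLeast (critLengths ((maxCycleMean M)⁻¹ • M) k)
      (girth (component (criticalGraph M) k)) := by
  have h0 := maxCycleMean_ne_zero hk
  have hN := closedLeOne_inv_smul h0
  obtain ⟨p, hp, hkp⟩ := exists_closed_of_isCriticalNode hk
  set N := (maxCycleMean M)⁻¹ • M
  have hne : (critLengths N k).Nonempty := ⟨p, hp, k, ⟨0, CritWalk.refl N k⟩, hkp⟩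
  have hsub : {ℓ | ∃ w, IsCycle (component (criticalGraph M) k) ℓ w} ⊆ critLengths N k := by
    rintro ℓ ⟨w, hw⟩
    have h1 := (hw.2.1 0 hw.1).1
    rw [componentNodes_criticalGraph h0] at h1
    refine ⟨hw.1, w 0, h1, (critWalk_self_iff hN).1 ?_⟩
    have h2 := critWalk_of_isWalk h0 fun i hi => (hw.2.1 i hi).2.2
    rwa [hw.2.2.1] at h2
  obtain ⟨g, hg⟩ : ∃ g, IsLeast (critLengths N k) g :=
    ⟨sInf (critLengths N k), Nat.sInf_mem hne, fun _ h => Nat.sInf_le h⟩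
  -- A shortest critical closed walk cannot repeat a node, so it is a cycle of the component.
  have hmem : ∃ w, IsCycle (component (criticalGraph M) k) g w := by
    obtain ⟨⟨hg0, b, ⟨s, hs⟩, hb⟩, hmin⟩ := hg
    obtain ⟨w, rfl, hwg, hw⟩ := ((critWalk_self_iff hN).2 hb).exists_walk hN
    have hnode : ∀ i ≤ g, w i ∈ critNodes N k := fun i hi =>
      ⟨_, hs.trans hN (hw 0 i (Nat.zero_le i) hi)⟩
    refine ⟨w, hg0, fun i hi => ?_, hwg, ?_⟩
    · simp only [component, componentNodes_criticalGraph h0]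
      refine ⟨hnode i hi.le, hnode (i + 1) hi, (criticalGraph_adj_iff h0).2 ?_⟩
      simpa using hw i (i + 1) (Nat.le_succ i) hi
    · by_contra hinj
      obtain ⟨i, j, hij, hj, heq⟩ := exists_repeat_of_not_injOn hinj
      have h1 := hw i j hij.le hj.le
      rw [← heq, critWalk_self_iff hN] at h1
      have := hmin ⟨by omega, w i, hnode i (by omega), h1⟩
      omega
  have hgirth : girth (component (criticalGraph M) k) = g :=
    le_antisymm (Nat.sInf_le hmem) (hg.2 (hsub (Nat.sInf_mem ⟨g, hmem⟩)))
  rwa [hgirth]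

end Square

theorem maxMul_smul_smul {ι ρ : Type*} [Fintype ρ] (a b : ℝ≥0) (V : Matrix ι ρ ℝ≥0)
    (U : Matrix ρ ι ℝ≥0) : maxMul (a • V) (b • U) = (a * b) • maxMul V U := by
  ext i j : 1
  simp only [maxMul, Matrix.of_apply, Matrix.smul_apply, smul_eq_mul, NNReal.mul_finset_sup]
  exact Finset.sup_congr rfl fun k _ => by ring

/-! ### Cyclic classes of an irreducible matrix -/

/-- A term with a vanishing factor could be dropped from the factorization, contradicting the
minimality of `r`. -/
theorem exists_ne_zero_of_isFactorRank {ι : Type*} {A : Matrix ι ι ℝ≥0} {r : ℕ}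
    (hr : IsFactorRank A r) {V W : Matrix ι (Fin r) ℝ≥0} (hVW : IsFactorization A V W)
    (α : Fin r) : ∃ i j, V i α ≠ 0 ∧ W j α ≠ 0 := by
  by_contra! h
  rcases r with - | r
  · exact α.elim0
  have hzero : ∀ i j, V i α * W j α = 0 := fun i j => by
    by_cases hi : V i α = 0
    · simp [hi]
    · simp [h i j hi]
  have hmem : r ∈ {s : ℕ | ∃ V W : Matrix ι (Fin s) ℝ≥0, IsFactorization A V W} := by
    refine ⟨V.submatrix id α.succAbove, W.submatrix id α.succAbove, ?_⟩
    rw [IsFactorization] at hVW ⊢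
    rw [hVW]
    ext i j : 1
    apply le_antisymm
    · refine maxMul_le fun β => ?_
      rcases eq_or_ne β α with rfl | hβ
      · rw [Matrix.transpose_apply, hzero]; exact zero_le
      · obtain ⟨γ, rfl⟩ := Fin.exists_succAbove_eq hβ
        exact le_maxMul (V.submatrix id α.succAbove) (W.submatrix id α.succAbove).transpose i γ j
    · exact maxMul_le fun γ => le_maxMul V W.transpose i (α.succAbove γ) j
  have := hr.2 hmem
  omega

/-- Give `α` the class of any `i` with `V i α ≠ 0`. All choices agree, since any `j` with `U α j ≠
0` lies one class after each of them. -/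
theorem exists_classes_of_factorization {ι ρ : Type*} [Fintype ρ] {V : Matrix ι ρ ℝ≥0}
    {U : Matrix ρ ι ℝ≥0} {d : ℕ} {cl : ι → ZMod d}
    (hcl : ∀ i j, maxMul V U i j ≠ 0 → cl j = cl i + 1)
    (hne : ∀ α, ∃ i j, V i α ≠ 0 ∧ U α j ≠ 0) :
    ∃ clB : ρ → ZMod d, (∀ i α, V i α ≠ 0 → clB α = cl i) ∧
      ∀ α i, U α i ≠ 0 → cl i = clB α + 1 := by
  have hcl' : ∀ i α j, V i α ≠ 0 → U α j ≠ 0 → cl j = cl i + 1 := fun i α j h₁ h₂ =>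
    hcl i j fun h => mul_ne_zero h₁ h₂ (le_antisymm (h ▸ le_maxMul V U i α j) zero_le)
  choose a b hab using hne
  refine ⟨fun α => cl (a α), fun i α h => ?_, fun α i h => hcl' _ α _ (hab α).1 h⟩
  have h1 := hcl' i α _ h (hab α).2
  rw [hcl' _ α _ (hab α).1 (hab α).2, add_left_inj] at h1
  exact h1

theorem cyclicity_ne_zero {ι : Type*} {A : Matrix ι ι ℝ≥0} {k : ι} (hk : IsCriticalNode A k) :
    cyclicity (digraph A) ≠ 0 := by
  obtain ⟨ℓ, w, ⟨hw, -⟩, -⟩ := hk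
  intro h0
  have : cyclicity (digraph A) ∣ ℓ := Nat.setGcd_dvd_of_mem ⟨w, hw⟩
  rw [h0, zero_dvd_iff] at this
  exact hw.1.ne' this

section Square

variable {ι : Type*} [Fintype ι] [DecidableEq ι]

/-- The class of a node is the length modulo the cyclicity of a chosen walk from `k`. A common
return to `k` shows that two walks with the same ends have congruent lengths. -/
theorem exists_class_of_isIrreducible {A : Matrix ι ι ℝ≥0} (hA : IsIrreducible A) (k : ι) :
    ∃ cl : ι → ZMod (cyclicity (digraph A)), ∀ i j, A i j ≠ 0 → cl j = cl i + 1 := by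
  set d := cyclicity (digraph A)
  have hdvd : ∀ t i, maxPow A t i i ≠ 0 → d ∣ t :=
    dvd_of_closed_walk fun ℓ w hw => Nat.setGcd_dvd_of_mem ⟨w, hw⟩
  have hreach : ∀ i j, ∃ t, maxPow A t i j ≠ 0 := by
    intro i j
    obtain ⟨t, w, hw, rfl, rfl⟩ := hA i j
    refine ⟨t, fun h => walkWeight_ne_zero_iff.2 hw ?_⟩
    exact le_antisymm (h ▸ walkWeight_le_maxPow A t w) zero_le
  have hadd : ∀ {s t i j l}, maxPow A s i j ≠ 0 → maxPow A t j l ≠ 0 →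
      maxPow A (s + t) i l ≠ 0 := fun {s t i j l} h₁ h₂ h => mul_ne_zero h₁ h₂
    (le_antisymm (h ▸ le_maxPow_add A s t i j l) zero_le)
  choose f hf using hreach k
  refine ⟨fun i => (f i : ZMod d), fun i j hij => ?_⟩
  obtain ⟨t, ht⟩ := hreach j k
  have h1 := hdvd _ _ (hadd (hf j) ht)
  rw [← maxPow_one A] at hij
  have h2 := hdvd _ _ (hadd (hadd (hf i) hij) ht)
  rw [← ZMod.natCast_eq_zero_iff] at h1 h2
  push_cast at h1 h2
  rw [← h2, add_left_inj] at h1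
  exact h1

/-! ### Transposition -/

theorem ClosedLeOne.transpose {M : Matrix ι ι ℝ≥0} (hM : ClosedLeOne M) :
    ClosedLeOne M.transpose := fun t i => by
  rw [maxPow_transpose]; exact hM t i

theorem critNodes_transpose (M : Matrix ι ι ℝ≥0) (a : ι) :
    critNodes M.transpose a = critNodes M a := by
  have key : ∀ (M : Matrix ι ι ℝ≥0) b, b ∈ critNodes M a → b ∈ critNodes M.transpose a := by
    rintro M b ⟨s, s', h⟩
    exact ⟨s', s, by rwa [maxPow_transpose, maxPow_transpose, Matrix.transpose_apply,
      Matrix.transpose_apply, mul_comm]⟩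
  ext b
  exact ⟨fun h => by simpa using key _ b h, key M b⟩

theorem critLengths_transpose (M : Matrix ι ι ℝ≥0) (a : ι) :
    critLengths M.transpose a = critLengths M a := by
  simp only [critLengths, critNodes_transpose, maxPow_transpose, Matrix.transpose_apply]

/-! ### Transients -/

theorem maxPow_add_eq_of_inv_smul {A : Matrix ι ι ℝ≥0} {c : ℝ≥0} (hc : c ≠ 0) {p X : ℕ} {i j : ι}
    (h : maxPow (c⁻¹ • A) (p + X) i j = maxPow (c⁻¹ • A) X i j) :
    maxPow A (p + X) i j = c ^ p * maxPow A X i j := by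
  rw [maxPow_smul, maxPow_smul, Matrix.smul_apply, Matrix.smul_apply, smul_eq_mul, smul_eq_mul,
    pow_add, inv_pow, inv_pow] at h
  field_simp at h
  exact h

theorem exists_isRowTransient {A : Matrix ι ι ℝ≥0} {k : ι} (h0 : maxCycleMean A ≠ 0) {Y : ℕ}
    (hY : RowPeriodicFrom ((maxCycleMean A)⁻¹ • A) k Y) :
    ∃ t, IsRowTransient A k t ∧
      ∀ X, RowPeriodicFrom ((maxCycleMean A)⁻¹ • A) k X → t ≤ X := by
  have hmem : ∀ X, RowPeriodicFrom ((maxCycleMean A)⁻¹ • A) k X → ∃ p : ℕ, 0 < p ∧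
      ∀ i, maxPow A (p + X) k i = maxCycleMean A ^ p * maxPow A X k i := by
    rintro X ⟨p, hp, h⟩
    exact ⟨p, hp, fun i => maxPow_add_eq_of_inv_smul h0 (h i)⟩
  exact ⟨_, ⟨Nat.sInf_mem ⟨Y, hmem Y hY⟩, fun _ h => Nat.sInf_le h⟩,
    fun X hX => Nat.sInf_le (hmem X hX)⟩

theorem exists_isColTransient {A : Matrix ι ι ℝ≥0} {k : ι} (h0 : maxCycleMean A ≠ 0) {Y : ℕ}
    (hY : RowPeriodicFrom ((maxCycleMean A)⁻¹ • A).transpose k Y) :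
    ∃ t, IsColTransient A k t ∧
      ∀ X, RowPeriodicFrom ((maxCycleMean A)⁻¹ • A).transpose k X → t ≤ X := by
  have hmem : ∀ X, RowPeriodicFrom ((maxCycleMean A)⁻¹ • A).transpose k X → ∃ p : ℕ, 0 < p ∧
      ∀ i, maxPow A (p + X) i k = maxCycleMean A ^ p * maxPow A X i k := by
    rintro X ⟨p, hp, h⟩
    refine ⟨p, hp, fun i => maxPow_add_eq_of_inv_smul h0 ?_⟩
    simpa only [maxPow_transpose, Matrix.transpose_apply] using h i
  exact ⟨_, ⟨Nat.sInf_mem ⟨Y, hmem Y hY⟩, fun _ h => Nat.sInf_le h⟩,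
    fun X hX => Nat.sInf_le (hmem X hX)⟩

/-- The bounds for rows and columns in terms of a partition into cyclic classes. -/
theorem rowPeriodicFrom_of_classes {ρ : Type*} [Fintype ρ] [DecidableEq ρ] {A : Matrix ι ι ℝ≥0}
    {V W : Matrix ι ρ ℝ≥0} (hVW : IsFactorization A V W) {k : ι} (hk : IsCriticalNode A k) {d : ℕ}
    (hd : d ≠ 0) {clA : ι → ZMod d} {clB : ρ → ZMod d}
    (hV : ∀ i α, V i α ≠ 0 → clB α = clA i) (hW : ∀ i α, W i α ≠ 0 → clA i = clB α + 1)
    {N : Matrix ι ι ℝ≥0}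
    (hN : N = (maxCycleMean A)⁻¹ • A ∨ N = ((maxCycleMean A)⁻¹ • A).transpose) :
    RowPeriodicFrom N k (d * wielandt (Fintype.card ρ / d) + Fintype.card ρ % d + 1) ∧
      ∃ X, RowPeriodicFrom N k (X + 1) ∧
        X + 2 * girth (component (criticalGraph A) k) ≤
          Fintype.card ρ / d * girth (component (criticalGraph A) k) +
            min (Fintype.card ρ) (min (componentNodes (criticalGraph A) k).ncard
              (relatedNodes V W k).ncard + Fintype.card ρ % d) := by
  have : NeZero d := ⟨hd⟩
  have h0 := maxCycleMean_ne_zero hk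
  have hcl := closedLeOne_inv_smul h0
  obtain ⟨p, hp, hkp⟩ := exists_closed_of_isCriticalNode hk
  have hg := isLeast_girth_component hk
  -- A step of `A` is two steps of the bipartite matrix, whose maximum cycle mean is therefore the
  -- square root.
  set e := NNReal.sqrt (maxCycleMean A) with he
  have he0 : e ≠ 0 := by simpa [he] using h0
  have hfac : (maxCycleMean A)⁻¹ • A = maxMul (e⁻¹ • V) (e⁻¹ • W.transpose) := by
    rw [maxMul_smul_smul, ← mul_inv, he, NNReal.mul_self_sqrt, ← hVW]
  have hZ : offDiag (e⁻¹ • V) (e⁻¹ • W.transpose) = e⁻¹ • bipartiteMatrix V W := by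
    simp [offDiag, bipartiteMatrix, Matrix.fromBlocks_smul]
  rw [componentNodes_criticalGraph h0]
  rw [hfac] at hcl hkp hg hN ⊢
  have hZcl := closedLeOne_offDiag hcl
  have hZp : maxPow (offDiag (e⁻¹ • V) (e⁻¹ • W.transpose)) (2 * p) (.inl k) (.inl k) = 1 := by
    rw [maxPow_offDiag_inl, hkp]
  have hmean : maxCycleMean (bipartiteMatrix V W) = e :=
    maxCycleMean_eq_of_closed he0 (hZ ▸ hZcl) (by omega : 0 < 2 * p) (hZ ▸ hZp)
  have hrel : relatedNodes V W k = {β | Sum.inr β ∈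
      critNodes (offDiag (e⁻¹ • V) (e⁻¹ • W.transpose)) (.inl k)} := by
    rw [relatedNodes, componentNodes_criticalGraph (hmean.trans_ne he0), hmean, hZ]
  rw [hrel]
  rcases hN with rfl | rfl
  · refine rowPeriodicFrom_factorization hcl (clA := clA) (clB := clB) ?_ ?_ hp hkp hg
    · intro i α h
      exact hV i α fun h' => h (by simp [h'])
    · intro α i h
      exact hW i α fun h' => h (by simp [h'])
  · rw [← critLengths_transpose] at hg
    rw [← critNodes_transpose (maxMul _ _), ← critNodes_transpose (offDiag _ _)]
    have hkp' : maxPow (maxMul (e⁻¹ • V) (e⁻¹ • W.transpose)).transpose p k k = 1 := by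
      rw [maxPow_transpose]; exact hkp
    have hcl' := hcl.transpose
    have hoff : (offDiag (e⁻¹ • V) (e⁻¹ • W.transpose)).transpose =
        offDiag (e⁻¹ • W.transpose).transpose (e⁻¹ • V).transpose := by
      simp [offDiag, Matrix.fromBlocks_transpose]
    rw [hoff]
    rw [maxMul_transpose] at hkp' hcl' hg ⊢
    -- Transposition reverses the edges, so the classes are negated; the extra `-1` restores the
    -- convention that the class increases on the second half-step.
    refine rowPeriodicFrom_factorization hcl' (clA := fun i => -clA i)
      (clB := fun α => -clB α - 1) ?_ ?_ hp hkp' hg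
    · intro i α h
      rw [hW i α fun h' => h (by simp [h'])]
      ring
    · intro α i h
      rw [hV i α fun h' => h (by simp [h'])]
      ring

end Square

end MaxAlg

/-! ### Assembly of the row and column bounds -/

theorem theorem2 (n r : ℕ) (A : Matrix (Fin n) (Fin n) ℝ≥0) (hr : IsFactorRank A r)
    (V W : Matrix (Fin n) (Fin r) ℝ≥0) (hVW : IsFactorization A V W)
    (k : Fin n) (hk : IsCriticalNode A k)
    (g cardH h : ℕ)
    (hg : g = girth (component (criticalGraph A) k))
    (hcardH : cardH = (componentNodes (criticalGraph A) k).ncard)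
    (hh : h = min cardH (relatedNodes V W k).ncard) :
    h ≤ min cardH r ∧
    ∃ tRow tCol : ℕ, IsRowTransient A k tRow ∧ IsColTransient A k tCol ∧
      ∀ T : ℕ, T = tRow ∨ T = tCol →
        (T : ℤ) ≤ (wielandt r : ℤ) + 1 ∧
        (T : ℤ) ≤ ((r : ℤ) - 2) * (g : ℤ) + (h : ℤ) + 1 ∧
        (IsIrreducible A → ∀ d : ℕ, d = cyclicity (digraph A) →
          (T : ℤ) ≤ (d : ℤ) * (wielandt (r / d) : ℤ) + ((r % d : ℕ) : ℤ) + 1 ∧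
          (T : ℤ) ≤ (((r / d : ℕ) : ℤ) - 2) * (g : ℤ)
            + ((min r (h + r % d) : ℕ) : ℤ) + 1) := by
  have h0 := maxCycleMean_ne_zero hk
  have hhr : h ≤ min cardH r := by
    have : (relatedNodes V W k).ncard ≤ r := by
      simpa using Set.ncard_le_card (relatedNodes V W k)
    omega
  -- the transients are bounded as soon as there are compatible classes
  have bounds : ∀ (d : ℕ) (clA : Fin n → ZMod d) (clB : Fin r → ZMod d), d ≠ 0 →
      (∀ i α, V i α ≠ 0 → clB α = clA i) → (∀ i α, W i α ≠ 0 → clA i = clB α + 1) →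
      ∀ N, (N = (maxCycleMean A)⁻¹ • A ∨ N = ((maxCycleMean A)⁻¹ • A).transpose) →
      RowPeriodicFrom N k (d * wielandt (r / d) + r % d + 1) ∧
        ∃ X, RowPeriodicFrom N k (X + 1) ∧ X + 2 * g ≤ r / d * g + min r (h + r % d) := by
    intro d clA clB hd hV hW N hN
    have := rowPeriodicFrom_of_classes hVW hk hd hV hW hN
    rwa [Fintype.card_fin, ← hcardH, ← hg, ← hh] at this
  -- A single class is always available; it gives the bounds that hold without irreducibility.
  have triv := fun N hN => bounds 1 (fun _ => 0) (fun _ => 0) one_ne_zero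
    (fun _ _ _ => rfl) (fun _ _ _ => Subsingleton.elim _ _) N hN
  obtain ⟨tRow, hRow, hRow'⟩ := exists_isRowTransient h0 (triv _ (Or.inl rfl)).1
  obtain ⟨tCol, hCol, hCol'⟩ := exists_isColTransient h0 (triv _ (Or.inr rfl)).1
  refine ⟨hhr, tRow, tCol, hRow, hCol, fun T hT => ?_⟩
  obtain ⟨N, hN, hT'⟩ : ∃ N, (N = (maxCycleMean A)⁻¹ • A ∨
      N = ((maxCycleMean A)⁻¹ • A).transpose) ∧ ∀ X, RowPeriodicFrom N k X → T ≤ X := by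
    rcases hT with rfl | rfl
    · exact ⟨_, Or.inl rfl, hRow'⟩
    · exact ⟨_, Or.inr rfl, hCol'⟩
  have final : ∀ d : ℕ, RowPeriodicFrom N k (d * wielandt (r / d) + r % d + 1) ∧
      (∃ X, RowPeriodicFrom N k (X + 1) ∧ X + 2 * g ≤ r / d * g + min r (h + r % d)) →
      (T : ℤ) ≤ (d : ℤ) * (wielandt (r / d) : ℤ) + ((r % d : ℕ) : ℤ) + 1 ∧
      (T : ℤ) ≤ (((r / d : ℕ) : ℤ) - 2) * (g : ℤ) + ((min r (h + r % d) : ℕ) : ℤ) + 1 := by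
    rintro d ⟨h1, X, h2, hX⟩
    have h3 := hT' _ h1
    have h4 := hT' _ h2
    zify at h3 h4 hX
    push_cast
    constructor <;> linarith
  have h1 := final 1 (triv N hN)
  rw [Nat.div_one, Nat.mod_one, add_zero, min_eq_right (hhr.trans (min_le_right _ _))] at h1
  refine ⟨by simpa using h1.1, h1.2, fun hirr d hd => final d ?_⟩
  subst hd
  obtain ⟨clA, hclA⟩ := exists_class_of_isIrreducible hirr k
  have hfac : A = maxMul V W.transpose := hVW
  obtain ⟨clB, hV, hU⟩ := exists_classes_of_factorization (V := V) (U := W.transpose)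
    (cl := clA) (fun i j hij => hclA i j (by rwa [hfac]))
    (fun α => exists_ne_zero_of_isFactorRank hr hVW α)
  exact bounds _ clA clB (cyclicity_ne_zero hk) hV (fun i α => hU α i) N hN
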